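/- Let $n\ge 5$ and $3\le\rho\le n$ be integers. Then there exists an I-isolated smooth Fano $n$-polytope with exactly $n+\rho$ vertices. Here a *lattice $n$-polytope* is a convex polytope $P\subset\mathbb R^n$ of dimension $n$ whose set $V(P)$ of vertices is contained in $\mathbb Z^n$. A *smooth Fano $n$-polytope* is a lattice $n$-polytope $P\subset\mathbb R^n$ that contains the origin in its interior and such that the vertex set of each facet of $P$ is a $\mathbb Z$-basis of $\mathbb Z^n$. Two lattice polytopes $Q,Q'\subset\mathbb R^n$ are *unimodularly equivalent* if there is an affine map $\phi:\mathbb R^n\to\mathbb R^n$ with $\phi(\mathbb Z^n)=\mathbb Z^n$ and $\phi(Q)=Q'$. Two smooth Fano $n$-polytopes $P$ and $Q$ are *I-equivalent* if there is a finite sequence $P_0,P_1,\dots,P_k$ ($k\ge 0$) of smooth Fano $n$-polytopes such that $P$ and $Q$ are unimodularly equivalent to $P_0$ and $P_k$, respectively, and, for each $1\le i\le k$, there is a point $w\in\mathbb Z^n$ with either $w\notin V(P_{i-1})$ and $V(P_i)=V(P_{i-1})\cup\{w\}$, or $w\notin V(P_i)$ and $V(P_{i-1})=V(P_i)\cup\{w\}$.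 A smooth Fano $n$-polytope $P$ is *I-isolated* if every smooth Fano $n$-polytope that is I-equivalent to $P$ is unimodularly equivalent to $P$. -/

import Mathlib

/-- The point of `ℝⁿ` with the given integer coordinates. -/
def latticeEmb {n : ℕ} (z : Fin n → ℤ) : Fin n → ℝ := fun i => (z i : ℝ)

/-- The standard lattice `ℤⁿ`, as a subset of `ℝⁿ`. -/
def stdLattice (n : ℕ) : Set (Fin n → ℝ) := Set.range latticeEmb

/-- The vertex set `V(P)` of a polytope (also used for its faces). -/
def vertexSet {n : ℕ} (P : Set (Fin n → ℝ)) : Set (Fin n → ℝ) := P.extremePoints ℝ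

/-- A lattice `n`-polytope in `ℝⁿ`: the convex hull of a finite set of points,
of dimension `n`, all of whose vertices are lattice points. -/
def IsLatticePolytope {n : ℕ} (P : Set (Fin n → ℝ)) : Prop :=
  (∃ s : Set (Fin n → ℝ), s.Finite ∧ P = convexHull ℝ s) ∧
    affineSpan ℝ P = ⊤ ∧ vertexSet P ⊆ stdLattice n

/-- A facet of `P`: a nonempty face (set of maximizers of a linear functional on `P`)
of dimension `n - 1`. -/
def IsFacet {n : ℕ} (P F : Set (Fin n → ℝ)) : Prop :=
  F.Nonempty ∧ IsExposed ℝ P F ∧ Module.finrank ℝ (vectorSpan ℝ F) + 1 = n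

/-- A smooth Fano `n`-polytope: a lattice `n`-polytope with the origin in its interior,
such that the vertices of each facet form a `ℤ`-basis of `ℤⁿ`. -/
def IsSmoothFano {n : ℕ} (P : Set (Fin n → ℝ)) : Prop :=
  IsLatticePolytope P ∧ (0 : Fin n → ℝ) ∈ interior P ∧
    ∀ F : Set (Fin n → ℝ), IsFacet P F →
      ∃ b : Module.Basis (Fin n) ℤ (Fin n → ℤ), vertexSet F = Set.range fun i => latticeEmb (b i)

/-- Unimodular equivalence: an affine map of `ℝⁿ` that maps `ℤⁿ` onto `ℤⁿ` maps `P` onto `Q`. -/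
def UnimodularlyEquivalent {n : ℕ} (P Q : Set (Fin n → ℝ)) : Prop :=
  ∃ φ : (Fin n → ℝ) →ᵃ[ℝ] (Fin n → ℝ), φ '' stdLattice n = stdLattice n ∧ φ '' P = Q

/-- `Q` is obtained from `P` by adding one lattice point `w` to the vertex set. -/
def AddsVertex {n : ℕ} (P Q : Set (Fin n → ℝ)) : Prop :=
  ∃ w ∈ stdLattice n, w ∉ vertexSet P ∧ vertexSet Q = vertexSet P ∪ {w}

/-- I-equivalence of smooth Fano polytopes `P` and `Q`: they are unimodularly equivalent to the
ends `S 0` and `S k` of a finite sequence of smooth Fano polytopes, in which consecutive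
vertex sets differ by adding or removing one lattice point. -/
def IEquivalent {n : ℕ} (P Q : Set (Fin n → ℝ)) : Prop :=
  ∃ (k : ℕ) (S : ℕ → Set (Fin n → ℝ)),
    (∀ i ≤ k, IsSmoothFano (S i)) ∧
    UnimodularlyEquivalent P (S 0) ∧ UnimodularlyEquivalent Q (S k) ∧
    ∀ i < k, AddsVertex (S i) (S (i + 1)) ∨ AddsVertex (S (i + 1)) (S i)

/-- A smooth Fano polytope is I-isolated if every smooth Fano `n`-polytope that is I-equivalent
to it is unimodularly equivalent to it. -/
def IsIIsolated {n : ℕ} (P : Set (Fin n → ℝ)) : Prop :=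
  ∀ Q : Set (Fin n → ℝ), IsSmoothFano Q → IEquivalent P Q → UnimodularlyEquivalent P Q

/-!
The polytope is given by its vertices, which are `t`, `z`, blocks `y` and `u` of size `p + 1`, a
block `v` of size `q + 2`, and blocks `x i`, and by the linear relations between them (`VtxRel`):
`t + z = 0`, `∑ y + z = ∑ u`, `∑ v + ∑ y = (p + q + 2) t`, and
`∑ x i = ∑ α i j y j + ∑ β i j u j`, where the size of `x i` exceeds the sum of the coefficients
by one. The sets of vertices `{t, z}`, `y ∪ {z}`, `u ∪ {t}`, `v ∪ y`, `u ∪ v` and `x i` are never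
contained in a facet, and the facets are the maximal sets of vertices without such a subset
(`VtxRel.exists_facet`). The vertices of every facet generate all vertices by the relations
(`VtxRel.mem_of_facet`), so the polytope is a smooth Fano polytope
(`IsRealization.isFacetSystem`). Realizations of the relations exist in the right dimension
(`exists_isRealization`), and the number of vertices is `n + 3` plus the number of blocks `x i`,
which is how `ρ` is prescribed.

Isolation means that no single step of an I-equivalence is possible.

*No vertex can be added* (`IsRealization.not_add_vertex`). In a polytope `Q` with one additional
vertex `w`, no old facet functional has the value `1` at `w`, and `w` lies beyond some old facet
and not beyond some other one. If two adjacent facets `F`, `F'` have the property that the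
functional of `F'` is `0` at the vertex of `F` not in `F'`, then `w` lies beyond `F'` if it lies
beyond `F` (`IsFacetSystem.two_le_of_adjacent`): otherwise the ridge together with `w` is a facet
of `Q`, so `w` has the coordinate `1` at that vertex, and the functionals of `F` and `F'` differ
by only `1` at `w`, which leaves no room between `≥ 2` and `≤ 0`. All facets except those of one
type, `zu`, are connected in both directions by such steps; thus they are all visible from `w` or
all invisible. The boundary of the visible part then separates a facet `zu j k` from the facet
`ty k j`, which determines the values at `w` of their functionals. The coordinates of `w` have
signs, by comparison with the other neighbouring facets, that contradict these values.

*No vertex can be removed* (`IsRealization.not_remove_vertex`). Either the origin is no longer an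
interior point, because some nonzero functional is nonnegative at the remaining vertices, or the
convex hull of the remaining vertices has a facet whose vertices are not a basis of the lattice,
because one of their coordinate functions would contradict a relation
(`IsRealization.false_of_dual`). This is where the restriction on the parameters (`IsRigid`) comes
in.

These two facts are applied not only to the polytope but also to its unimodular images; the latter
fix the origin, as it is the only interior lattice point
(`IsRealization.exists_of_unimodularlyEquivalent`).
-/

open Set Filter Topology

/-! ### Linear functionals on lattice polytopes -/

/-- The embedding `ℤⁿ → ℝⁿ` as a homomorphism of groups. -/
def latticeHom (n : ℕ) : (Fin n → ℤ) →+ (Fin n → ℝ) where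
  toFun := latticeEmb
  map_zero' := by ext i; simp [latticeEmb]
  map_add' a b := by ext i; simp [latticeEmb]

lemma latticeHom_apply {n : ℕ} (w : Fin n → ℤ) : latticeHom n w = latticeEmb w := rfl

lemma latticeEmb_injective {n : ℕ} : Function.Injective (latticeEmb (n := n)) := by
  intro a b h
  ext i
  have := congrFun h i
  simpa [latticeEmb] using this

/-- A homomorphism `ℤⁿ → ℝ` extends to a linear functional on `ℝⁿ`. -/
lemma exists_linear_extension {n : ℕ} (g : (Fin n → ℤ) →+ ℝ) :
    ∃ ψ : (Fin n → ℝ) →ₗ[ℝ] ℝ, ∀ w, ψ (latticeEmb w) = g w := by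
  refine ⟨(Pi.basisFun ℝ (Fin n)).constr ℝ fun i => g (Pi.single i 1), fun w => ?_⟩
  have hw : w = ∑ i, w i • (Pi.single i (1 : ℤ) : Fin n → ℤ) := by
    ext j
    simp [Finset.sum_apply, Pi.single_apply]
  conv_rhs => rw [hw, map_sum]
  simp only [Module.Basis.constr_apply_fintype, map_zsmul]
  simp [latticeEmb]

/-- A linear functional that vanishes on a set generating `ℤⁿ` vanishes. -/
lemma linear_eq_zero_of_closure {n : ℕ} {s : Set (Fin n → ℤ)} (hs : AddSubgroup.closure s = ⊤)
    {μ : (Fin n → ℝ) →ₗ[ℝ] ℝ} (h : ∀ w ∈ s, μ (latticeEmb w) = 0) : μ = 0 := by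
  have h1 : (μ.toAddMonoidHom.comp (latticeHom n)) = 0 := by
    refine AddMonoidHom.eq_of_eqOn_dense hs fun w hw => ?_
    simpa [latticeHom_apply] using h w hw
  refine (Pi.basisFun ℝ (Fin n)).ext fun i => ?_
  have := DFunLike.congr_fun h1 (Pi.single i 1)
  have h2 : latticeEmb (Pi.single i (1 : ℤ)) = (Pi.basisFun ℝ (Fin n)) i := by
    ext j
    simp [latticeEmb, Pi.single_apply]
  rw [← h2]
  simpa [latticeHom_apply] using this

/-- A polytope is the convex hull of its vertices. -/
lemma convexHull_vertexSet {n : ℕ} {P s : Set (Fin n → ℝ)} (hs : s.Finite)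
    (hP : P = convexHull ℝ s) : convexHull ℝ (vertexSet P) = P := by
  subst hP
  have hf : (vertexSet (convexHull ℝ s)).Finite := hs.subset extremePoints_convexHull_subset
  rw [← hf.isClosed_convexHull ℝ |>.closure_eq]
  exact closure_convexHull_extremePoints (hs.isCompact_convexHull ℝ) (convex_convexHull ℝ s)

lemma IsLatticePolytope.convexHull_vertexSet {n : ℕ} {P : Set (Fin n → ℝ)}
    (h : IsLatticePolytope P) : convexHull ℝ (vertexSet P) = P := by
  obtain ⟨⟨s, hs, hP⟩, -⟩ := h
  exact _root_.convexHull_vertexSet hs hP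

lemma linear_le_of_mem_convexHull {n : ℕ} {s : Set (Fin n → ℝ)} {ψ : (Fin n → ℝ) →ₗ[ℝ] ℝ} {c : ℝ}
    (h : ∀ v ∈ s, ψ v ≤ c) {x : Fin n → ℝ} (hx : x ∈ convexHull ℝ s) : ψ x ≤ c :=
  convexHull_min (t := {x | ψ x ≤ c}) h (convex_halfSpace_le ψ.isLinear c) hx

/-- A linear functional that is bounded above by `c` on a set is less than `c` in its interior,
unless it vanishes. -/
lemma linear_lt_of_mem_interior {n : ℕ} {s : Set (Fin n → ℝ)} {ψ : (Fin n → ℝ) →ₗ[ℝ] ℝ} {c : ℝ}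
    (h : ∀ v ∈ s, ψ v ≤ c) (hψ : ψ ≠ 0) {x : Fin n → ℝ} (hx : x ∈ interior s) : ψ x < c := by
  obtain ⟨y, hy⟩ : ∃ y, 0 < ψ y := by
    obtain ⟨y, hy⟩ : ∃ y, ψ y ≠ 0 := by
      by_contra! H
      exact hψ (LinearMap.ext H)
    rcases lt_or_gt_of_ne hy with h1 | h1
    · exact ⟨-y, by simpa using h1⟩
    · exact ⟨y, h1⟩
  have hc : Tendsto (fun t : ℝ => x + t • y) (𝓝[>] 0) (𝓝 x) := by
    have : Continuous fun t : ℝ => x + t • y := by fun_prop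
    have := this.tendsto 0
    simp only [zero_smul, add_zero] at this
    exact this.mono_left nhdsWithin_le_nhds
  obtain ⟨t, ht, ht0⟩ :=
    ((hc.eventually (mem_interior_iff_mem_nhds.1 hx)).and self_mem_nhdsWithin).exists
  have h1 := h _ ht
  have h2 : 0 < t * ψ y := mul_pos ht0 hy
  simp only [map_add, map_smul, smul_eq_mul] at h1
  linarith

/-- The supporting hyperplane of a functional `ψ ≤ 1` whose equality set among the vertices spans
the space cuts out a facet; hence in a smooth Fano polytope that equality set is a basis of the
lattice. -/
lemma IsSmoothFano.exists_basis {n : ℕ} (hn : 0 < n) {Q : Set (Fin n → ℝ)} (hQ : IsSmoothFano Q)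
    {ψ : (Fin n → ℝ) →ₗ[ℝ] ℝ} (hle : ∀ v ∈ vertexSet Q, ψ v ≤ 1)
    (hspan : ∀ μ : (Fin n → ℝ) →ₗ[ℝ] ℝ, (∀ v ∈ vertexSet Q, ψ v = 1 → μ v = 0) → μ = 0) :
    ∃ b : Module.Basis (Fin n) ℤ (Fin n → ℤ),
      {v ∈ vertexSet Q | ψ v = 1} = range fun i => latticeEmb (b i) := by
  obtain ⟨hP, h0, hfac⟩ := hQ
  have hleQ : ∀ x ∈ Q, ψ x ≤ 1 := fun x hx => by
    rw [← hP.convexHull_vertexSet] at hx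
    exact linear_le_of_mem_convexHull hle hx
  obtain ⟨s₀, hs₀, hψs₀⟩ : ∃ v ∈ vertexSet Q, ψ v = 1 := by
    by_contra! H
    have := hspan (LinearMap.proj ⟨0, hn⟩) fun v hv h => absurd h (H v hv)
    simpa using LinearMap.congr_fun this (Pi.single ⟨0, hn⟩ 1)
  set F : Set (Fin n → ℝ) := {x ∈ Q | ψ x = 1} with hF
  have hs₀F : s₀ ∈ F := ⟨extremePoints_subset hs₀, hψs₀⟩
  have hexp : IsExposed ℝ Q F := fun _ => by
    refine ⟨LinearMap.toContinuousLinearMap ψ, ?_⟩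
    ext x
    simp only [hF, mem_ofPred_eq, LinearMap.coe_toContinuousLinearMap']
    refine and_congr_right fun hx => ⟨fun h y hy => h ▸ hleQ y hy, fun h => ?_⟩
    exact le_antisymm (hleQ x hx) (hψs₀ ▸ h s₀ hs₀F.1)
  have hdim : Module.finrank ℝ (vectorSpan ℝ F) + 1 = n := by
    have hker : vectorSpan ℝ F ≤ LinearMap.ker ψ := by
      rw [vectorSpan_def, Submodule.span_le]
      rintro _ ⟨x, hx, y, hy, rfl⟩
      simp [hx.2, hy.2]
    have hne : vectorSpan ℝ F ≠ ⊤ := fun h => by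
      have : s₀ ∈ LinearMap.ker ψ := hker (h ▸ Submodule.mem_top)
      simp [hψs₀] at this
    have hlt := Submodule.finrank_lt hne
    have htop : vectorSpan ℝ F ⊔ Submodule.span ℝ {s₀} = ⊤ := by
      by_contra hne
      obtain ⟨μ, hμ0, hμ⟩ := Submodule.exists_le_ker_of_lt_top _ (lt_top_iff_ne_top.2 hne)
      refine hμ0 (hspan μ fun v hv hψ => ?_)
      have h1 : v - s₀ ∈ LinearMap.ker μ :=
        hμ (Submodule.mem_sup_left (vsub_mem_vectorSpan ℝ (s := F)
          ⟨extremePoints_subset hv, hψ⟩ hs₀F))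
      have h2 : s₀ ∈ LinearMap.ker μ :=
        hμ (Submodule.mem_sup_right (Submodule.mem_span_singleton_self s₀))
      simp only [LinearMap.mem_ker, map_sub] at h1 h2
      linarith
    have h3 := Submodule.finrank_add_le_finrank_add_finrank (vectorSpan ℝ F)
      (Submodule.span ℝ {s₀})
    have hs₀0 : s₀ ≠ 0 := fun h => by simp [h] at hψs₀
    have h4 := finrank_span_singleton (K := ℝ) hs₀0
    rw [htop, finrank_top] at h3
    simp only [Module.finrank_fin_fun] at h3 hlt
    omega
  obtain ⟨b, hb⟩ := hfac F ⟨⟨s₀, hs₀F⟩, hexp, hdim⟩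
  refine ⟨b, ?_⟩
  rw [← hb, vertexSet, vertexSet, hexp.isExtreme.extremePoints_eq]
  ext v
  simp only [hF, mem_ofPred_eq, mem_inter_iff]
  exact ⟨fun h => ⟨⟨extremePoints_subset h.1, h.2⟩, h.1⟩, fun h => ⟨h.2, h.1.2⟩⟩

/-- In a smooth Fano polytope, every vertex of a facet is separated from the other vertices of that
facet by an integral functional. -/
lemma IsSmoothFano.exists_dual {n : ℕ} (hn : 0 < n) {Q : Set (Fin n → ℝ)} (hQ : IsSmoothFano Q)
    {W : Set (Fin n → ℤ)} (hW : vertexSet Q = latticeEmb '' W)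
    {ψ : (Fin n → ℝ) →ₗ[ℝ] ℝ} (hle : ∀ w ∈ W, ψ (latticeEmb w) ≤ 1)
    (hspan : ∀ μ : (Fin n → ℝ) →ₗ[ℝ] ℝ,
      (∀ w ∈ W, ψ (latticeEmb w) = 1 → μ (latticeEmb w) = 0) → μ = 0)
    {w₀ : Fin n → ℤ} (hw₀ : w₀ ∈ W) (hψ : ψ (latticeEmb w₀) = 1) :
    ∃ l : (Fin n → ℤ) →+ ℤ, l w₀ = 1 ∧ ∀ w ∈ W, ψ (latticeEmb w) = 1 → w ≠ w₀ → l w = 0 := by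
  obtain ⟨b, hb⟩ := hQ.exists_basis hn (ψ := ψ)
    (by rw [hW]; rintro _ ⟨w, hw, rfl⟩; exact hle w hw)
    (fun μ hμ => hspan μ fun w hw h => hμ _ (hW ▸ mem_image_of_mem _ hw) h)
  have key : ∀ w ∈ W, ψ (latticeEmb w) = 1 → ∃ i, b i = w := fun w hw h => by
    have : latticeEmb w ∈ range fun i => latticeEmb (b i) := by
      rw [← hb]
      exact ⟨hW ▸ mem_image_of_mem _ hw, h⟩
    obtain ⟨i, hi⟩ := this
    exact ⟨i, latticeEmb_injective hi⟩
  obtain ⟨i, rfl⟩ := key w₀ hw₀ hψ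
  refine ⟨(b.coord i).toAddMonoidHom, by simp, fun w hw h hne => ?_⟩
  obtain ⟨j, rfl⟩ := key w hw h
  have : j ≠ i := fun h => hne (h ▸ rfl)
  simp [this]

/-- The polar dual of a polytope with the origin in its interior is compact, so a linear function
on it is maximized at a vertex of the dual, which is a functional `ψ ≤ 1` with a spanning equality
set. -/
lemma exists_spanning_functional {n : ℕ} {V : Set (Fin n → ℝ)} (hV : V.Finite)
    (h0 : (0 : Fin n → ℝ) ∈ interior (convexHull ℝ V)) (x : Fin n → ℝ)
    {φ : (Fin n → ℝ) →ₗ[ℝ] ℝ} (hφ : ∀ v ∈ V, φ v ≤ 1) :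
    ∃ ψ : (Fin n → ℝ) →ₗ[ℝ] ℝ, (∀ v ∈ V, ψ v ≤ 1) ∧
      (∀ μ : (Fin n → ℝ) →ₗ[ℝ] ℝ, (∀ v ∈ V, ψ v = 1 → μ v = 0) → μ = 0) ∧ φ x ≤ ψ x := by
  set D : Set ((Fin n → ℝ) →L[ℝ] ℝ) := {ψ | ∀ v ∈ V, ψ v ≤ 1} with hD
  have hclosed : IsClosed D := by
    simp only [hD, ofPred_forall]
    exact isClosed_biInter fun v _ => isClosed_le (by fun_prop) continuous_const
  have hbdd : Bornology.IsBounded D := by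
    set N := interior (convexHull ℝ V) ∩ -interior (convexHull ℝ V) with hN
    have hNn : N ∈ 𝓝 (0 : Fin n → ℝ) := by
      refine inter_mem (isOpen_interior.mem_nhds h0) (isOpen_interior.neg.mem_nhds ?_)
      simpa using h0
    refine (NormedSpace.isBounded_polar_of_mem_nhds_zero ℝ hNn).subset fun ψ hψ => ?_
    have hle : ∀ y ∈ convexHull ℝ V, ψ y ≤ 1 := fun y hy =>
      linear_le_of_mem_convexHull (ψ := (ψ : (Fin n → ℝ) →ₗ[ℝ] ℝ)) hψ hy
    refine (StrongDual.mem_polar_iff ℝ _).2 fun y hy => ?_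
    rw [Real.norm_eq_abs, abs_le]
    have h1 := hle y (interior_subset hy.1)
    have h2 := hle (-y) (interior_subset hy.2)
    rw [map_neg] at h2
    constructor <;> linarith
  have hcomp : IsCompact D := Metric.isCompact_of_isClosed_isBounded hclosed hbdd
  set ev : StrongDual ℝ ((Fin n → ℝ) →L[ℝ] ℝ) := ContinuousLinearMap.apply ℝ ℝ x
  have hφD : LinearMap.toContinuousLinearMap φ ∈ D := hφ
  obtain ⟨ψ₀, hψ₀, hmax⟩ := hcomp.exists_isMaxOn ⟨_, hφD⟩ ev.continuous.continuousOn
  set M : Set ((Fin n → ℝ) →L[ℝ] ℝ) := {ψ ∈ D | ∀ χ ∈ D, ev χ ≤ ev ψ} with hM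
  have hexp : IsExposed ℝ D M := fun _ => ⟨ev, rfl⟩
  obtain ⟨ψ, hψ⟩ := (hexp.isCompact hcomp).extremePoints_nonempty ⟨ψ₀, hψ₀, hmax⟩
  have hψM : ψ ∈ M := hψ.1
  have hψD : ψ ∈ D.extremePoints ℝ := hexp.isExtreme.extremePoints_subset_extremePoints hψ
  refine ⟨ψ, hψM.1, fun μ hμ => ?_, hψM.2 _ hφD⟩
  obtain ⟨ε, hε, hε0⟩ : ∃ ε : ℝ, (∀ v ∈ V, ε * |μ v| ≤ 1 - ψ v) ∧ 0 < ε := by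
    have : ∀ᶠ ε : ℝ in 𝓝[>] 0, ∀ v ∈ V, ε * |μ v| ≤ 1 - ψ v := by
      refine (eventually_all_finite hV).2 fun v hv => ?_
      rcases (hψM.1 v hv).eq_or_lt with h1 | h1
      · exact Eventually.of_forall fun ε => by simp [hμ v hv h1, h1]
      · have hc : Tendsto (fun ε : ℝ => ε * |μ v|) (𝓝[>] 0) (𝓝 0) := by
          have : Continuous fun ε : ℝ => ε * |μ v| := by fun_prop
          have := this.tendsto 0
          rw [zero_mul] at this
          exact this.mono_left nhdsWithin_le_nhds
        filter_upwards [hc.eventually (gt_mem_nhds (sub_pos.2 h1))] with ε h using h.le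
    exact (this.and self_mem_nhdsWithin).exists
  set μ' := ε • LinearMap.toContinuousLinearMap μ with hμ'
  have hv : ∀ v, μ' v = ε * μ v := fun v => rfl
  have hmem : ∀ s : ℝ, |s| ≤ 1 → ψ + s • μ' ∈ D := fun s hs v hvV => by
    have h1 := hε v hvV
    have h2 : s * (ε * μ v) ≤ ε * |μ v| := by
      calc s * (ε * μ v) ≤ |s * (ε * μ v)| := le_abs_self _
        _ = |s| * (ε * |μ v|) := by rw [abs_mul, abs_mul, abs_of_pos hε0]
        _ ≤ 1 * (ε * |μ v|) := by gcongr
        _ = _ := one_mul _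
    simp only [add_apply, smul_apply, hv, smul_eq_mul]
    linarith
  have h2 := hψD.2 (hmem 1 (by simp)) (hmem (-1) (by simp))
    ⟨1 / 2, 1 / 2, by norm_num, by norm_num, by norm_num, by module⟩
  have h3 : μ' = 0 := by simpa using h2
  ext1 i
  have h4 := DFunLike.congr_fun h3 (Pi.single i 1)
  rw [hv] at h4
  have : μ (Pi.single i 1) = 0 := (mul_eq_zero.1 h4).resolve_left hε0.ne'
  ext
  simpa using this

/-! ### Smooth Fano polytopes from facet functionals -/

/-- Points of `ℤⁿ` (indexed by `T`) and integral functionals (indexed by `𝓕`) that describe a smooth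
Fano polytope: every functional takes the value `1` at the points of a basis of `ℤⁿ` and values `≤ 0`
at the other points, and every real functional that is at most `1` at all points attains the value `1`
only at points of one of these bases. -/
structure IsFacetSystem {n : ℕ} {T 𝓕 : Type} (pt : T → Fin n → ℤ)
    (fn : 𝓕 → (Fin n → ℤ) →+ ℤ) : Prop where
  fn_pt : ∀ F x, fn F (pt x) = 1 ∨ fn F (pt x) ≤ 0
  closure_eq_top : ∀ F, AddSubgroup.closure (pt '' {x | fn F (pt x) = 1}) = ⊤
  card_eq : ∀ F, Nat.card {x // fn F (pt x) = 1} = n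
  exists_facet : ∀ x, ∃ F, fn F (pt x) = 1
  complete : ∀ ψ : (Fin n → ℝ) →ₗ[ℝ] ℝ, (∀ x, ψ (latticeEmb (pt x)) ≤ 1) →
    ∃ F, ∀ x, ψ (latticeEmb (pt x)) = 1 → fn F (pt x) = 1
  eq_zero_of_nonpos : ∀ ψ : (Fin n → ℝ) →ₗ[ℝ] ℝ, (∀ x, ψ (latticeEmb (pt x)) ≤ 0) → ψ = 0

/-- If no nonzero functional is nonpositive on `V`, the origin is an interior point of the convex hull
of `V`. -/
lemma zero_mem_interior_convexHull {n : ℕ} {V : Set (Fin n → ℝ)} (hne : V.Nonempty)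
    (h : ∀ ψ : (Fin n → ℝ) →ₗ[ℝ] ℝ, (∀ v ∈ V, ψ v ≤ 0) → ψ = 0) :
    (0 : Fin n → ℝ) ∈ interior (convexHull ℝ V) := by
  obtain ⟨v₀, hv₀⟩ := hne
  have hint : (interior (convexHull ℝ V)).Nonempty := by
    rw [(convex_convexHull ℝ V).interior_nonempty_iff_affineSpan_eq_top, affineSpan_convexHull,
      AffineSubspace.affineSpan_eq_top_iff_vectorSpan_eq_top_of_nonempty ℝ _ _ ⟨v₀, hv₀⟩]
    by_contra hne
    obtain ⟨μ, hμ0, hμ⟩ := Submodule.exists_le_ker_of_lt_top _ (lt_top_iff_ne_top.2 hne)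
    have hc : ∀ v ∈ V, μ v = μ v₀ := fun v hv => by
      have : v - v₀ ∈ LinearMap.ker μ := hμ (vsub_mem_vectorSpan ℝ hv hv₀)
      simpa [sub_eq_zero] using this
    rcases le_total (μ v₀) 0 with h1 | h1
    · exact hμ0 (h μ fun v hv => (hc v hv).trans_le h1)
    · refine hμ0 (neg_eq_zero.1 (h (-μ) fun v hv => ?_))
      simpa [hc v hv] using h1
  by_contra h0
  obtain ⟨f, hf⟩ := geometric_hahn_banach_open_point (convex_convexHull ℝ V).interior
    isOpen_interior h0
  rw [map_zero] at hf
  have hcl : ∀ v ∈ V, f v ≤ 0 := fun v hv => by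
    have h1 : v ∈ closure (interior (convexHull ℝ V)) := by
      rw [(convex_convexHull ℝ V).closure_interior_eq_closure_of_nonempty_interior hint]
      exact subset_closure (subset_convexHull ℝ V hv)
    exact closure_minimal (t := {x | f x ≤ 0}) (fun x hx => (hf x hx).le)
      (isClosed_le f.continuous continuous_const) h1
  have hf0 : (f : (Fin n → ℝ) →ₗ[ℝ] ℝ) = 0 := h _ hcl
  obtain ⟨y, hy⟩ := hint
  have h1 := hf y hy
  have h2 : f y = 0 := LinearMap.congr_fun hf0 y
  linarith

namespace IsFacetSystem

variable {n : ℕ} {T 𝓕 : Type} {pt : T → Fin n → ℤ} {fn : 𝓕 → (Fin n → ℤ) →+ ℤ}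

lemma exists_basis [Finite T] (h : IsFacetSystem pt fn) (F : 𝓕) :
    ∃ b : Module.Basis {x // fn F (pt x) = 1} ℤ (Fin n → ℤ), ∀ x, b x = pt x := by
  have := Fintype.ofFinite {x // fn F (pt x) = 1}
  refine ⟨basisOfTopLeSpanOfCardEqFinrank (fun x : {x // fn F (pt x) = 1} => pt x) ?_ ?_, fun x => ?_⟩
  · have h1 := h.closure_eq_top F
    have h2 : range (fun x : {x // fn F (pt x) = 1} => pt x) = pt '' {x | fn F (pt x) = 1} := by
      ext w
      simp
    intro w _
    rw [h2, ← Submodule.mem_toAddSubgroup, Submodule.span_int_eq_addSubgroupClosure, h1]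
    trivial
  · rw [← Nat.card_eq_fintype_card, h.card_eq F]
    simp
  · simp

lemma pt_injective [Finite T] (h : IsFacetSystem pt fn) : Function.Injective pt := by
  intro x y hxy
  obtain ⟨F, hF⟩ := h.exists_facet x
  obtain ⟨b, hb⟩ := h.exists_basis F
  have hF' : fn F (pt y) = 1 := hxy ▸ hF
  have := b.injective (a₁ := ⟨x, hF⟩) (a₂ := ⟨y, hF'⟩) (by simpa only [hb] using hxy)
  simpa using this

/-- The coordinates of a lattice point with respect to the basis belonging to a facet, extended by
zero. -/
lemma exists_coeff [Fintype T] (h : IsFacetSystem pt fn) (F : 𝓕) (w : Fin n → ℤ) :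
    ∃ c : T → ℤ, w = ∑ x, c x • pt x ∧ ∀ x, fn F (pt x) ≠ 1 → c x = 0 := by
  classical
  obtain ⟨b, hb⟩ := h.exists_basis F
  refine ⟨fun x => if hx : fn F (pt x) = 1 then b.repr w ⟨x, hx⟩ else 0, ?_, fun x hx => by simp [hx]⟩
  conv_lhs => rw [← b.sum_repr w]
  refine Fintype.sum_of_injective Subtype.val Subtype.val_injective _ _ (fun x hx => ?_) fun x => ?_
  · have hx' : ¬fn F (pt x) = 1 := fun h => hx ⟨⟨x, h⟩, rfl⟩
    simp only [dif_neg hx', zero_smul]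
  · simp only [dif_pos x.2, hb]

/-- Every point is separated from the other points by a real functional. -/
lemma exists_separating [Finite T] (h : IsFacetSystem pt fn) (x : T) :
    ∃ (ψ : (Fin n → ℝ) →ₗ[ℝ] ℝ) (c : ℝ), c < ψ (latticeEmb (pt x)) ∧
      ∀ y ≠ x, ψ (latticeEmb (pt y)) ≤ c := by
  classical
  obtain ⟨F, hF⟩ := h.exists_facet x
  obtain ⟨b, hb⟩ := h.exists_basis F
  set l : (Fin n → ℤ) →+ ℤ := (b.coord ⟨x, hF⟩).toAddMonoidHom with hl
  have hlx : l (pt x) = 1 := by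
    have : l (b ⟨x, hF⟩) = 1 := by simp [hl]
    rwa [hb] at this
  have hly : ∀ y ≠ x, fn F (pt y) = 1 → l (pt y) = 0 := fun y hy hFy => by
    have : l (b ⟨y, hFy⟩) = 0 := by simp [hl, hy]
    rwa [hb] at this
  obtain ⟨N, hN⟩ := (finite_range fun y => l (pt y)).bddAbove
  have hN' : ∀ y, l (pt y) ≤ N := fun y => hN (mem_range_self y)
  -- The functional `N • fn F + l` is `N + 1` at `pt x` and at most `N` at the other points.
  obtain ⟨ψ, hψ⟩ := exists_linear_extension
    ((Int.castAddHom ℝ).comp (N • fn F + l))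
  refine ⟨ψ, N, ?_, fun y hy => ?_⟩
  · rw [hψ]
    simp [hF, hlx]
  · rw [hψ]
    have hN0 : 1 ≤ N := hlx ▸ hN' x
    have : N * fn F (pt y) + l (pt y) ≤ N := by
      rcases h.fn_pt F y with h1 | h1
      · rw [h1, hly y hy h1]; omega
      · have := hN' y
        nlinarith
    simpa using (Int.cast_le (R := ℝ)).2 this

lemma vertexSet_eq [Finite T] (h : IsFacetSystem pt fn) :
    vertexSet (convexHull ℝ (range fun x => latticeEmb (pt x))) =
      range fun x => latticeEmb (pt x) := by
  set V := range fun x => latticeEmb (pt x)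
  refine Subset.antisymm extremePoints_convexHull_subset ?_
  rintro _ ⟨x, rfl⟩
  by_contra hx
  have hfin : V.Finite := finite_range _
  have hP := convexHull_vertexSet hfin rfl
  obtain ⟨ψ, c, hc, hψ⟩ := h.exists_separating x
  have h1 : latticeEmb (pt x) ∈ convexHull ℝ (vertexSet (convexHull ℝ V)) := by
    rw [hP]
    exact subset_convexHull ℝ V (mem_range_self x)
  have h2 := linear_le_of_mem_convexHull (ψ := ψ) (c := c) (fun v hv => ?_) h1
  · linarith
  · obtain ⟨y, rfl⟩ := extremePoints_convexHull_subset hv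
    refine hψ y ?_
    rintro rfl
    exact hx hv

lemma zero_mem_interior [Finite T] (hn : 0 < n) (h : IsFacetSystem pt fn) :
    (0 : Fin n → ℝ) ∈ interior (convexHull ℝ (range fun x => latticeEmb (pt x))) := by
  refine zero_mem_interior_convexHull ?_ fun ψ hψ =>
    h.eq_zero_of_nonpos ψ fun x => hψ _ (mem_range_self x)
  by_contra hne
  rw [not_nonempty_iff_eq_empty, range_eq_empty_iff] at hne
  have := h.eq_zero_of_nonpos (LinearMap.proj ⟨0, hn⟩) fun x => hne.elim x
  simpa using LinearMap.congr_fun this (Pi.single ⟨0, hn⟩ 1)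

/-- The convex hull of the points of a facet system is a smooth Fano polytope: a facet has at least `n`
vertices, and they lie in the basis of one of the functionals of the system, hence exhaust it. -/
theorem isSmoothFano [Finite T] (hn : 0 < n) (h : IsFacetSystem pt fn) :
    IsSmoothFano (convexHull ℝ (range fun x => latticeEmb (pt x))) := by
  set V := range fun x => latticeEmb (pt x) with hV
  have hfin : V.Finite := finite_range _
  have h0 := h.zero_mem_interior hn
  refine ⟨⟨⟨V, hfin, rfl⟩, ?_, ?_⟩, h0, ?_⟩
  · exact (convex_convexHull ℝ V).interior_nonempty_iff_affineSpan_eq_top.1 ⟨0, h0⟩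
  · rw [h.vertexSet_eq]
    rintro _ ⟨x, rfl⟩
    exact ⟨pt x, rfl⟩
  · rintro F ⟨⟨x₀, hx₀⟩, hexp, hdim⟩
    obtain ⟨l, hl⟩ := hexp ⟨x₀, hx₀⟩
    have hx₀' : x₀ ∈ convexHull ℝ V ∧ ∀ y ∈ convexHull ℝ V, l y ≤ l x₀ := by
      rw [hl] at hx₀; exact hx₀
    have hlV : ∀ v ∈ V, l v ≤ l x₀ := fun v hv => hx₀'.2 v (subset_convexHull ℝ V hv)
    have hl0 : (l : (Fin n → ℝ) →ₗ[ℝ] ℝ) ≠ 0 := fun hl0 => by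
      have hl0' : ∀ y, l y = 0 := fun y => LinearMap.congr_fun hl0 y
      have hFP : F = convexHull ℝ V := by
        rw [hl]; ext y; simp [hl0']
      have h1 : vectorSpan ℝ F = ⊤ := by
        rw [hFP, ← direction_affineSpan,
          (convex_convexHull ℝ V).interior_nonempty_iff_affineSpan_eq_top.1 ⟨0, h0⟩,
          AffineSubspace.direction_top]
      rw [h1, finrank_top, Module.finrank_fin_fun] at hdim
      omega
    have hpos : 0 < l x₀ := by
      have := linear_lt_of_mem_interior (ψ := (l : (Fin n → ℝ) →ₗ[ℝ] ℝ)) (s := convexHull ℝ V)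
        (fun v hv => hx₀'.2 v hv) hl0 h0
      simpa using this
    have hvF : vertexSet F = F ∩ V := by
      rw [vertexSet, hexp.isExtreme.extremePoints_eq, ← vertexSet, h.vertexSet_eq]
    obtain ⟨G, hG⟩ := h.complete ((l x₀)⁻¹ • (l : (Fin n → ℝ) →ₗ[ℝ] ℝ)) fun x => by
      have := hlV _ (mem_range_self x)
      simp only [LinearMap.smul_apply, smul_eq_mul, ContinuousLinearMap.coe_coe]
      rwa [inv_mul_le_iff₀ hpos, mul_one]
    have hsub : vertexSet F ⊆ (fun x => latticeEmb (pt x)) '' {x | fn G (pt x) = 1} := by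
      rw [hvF]
      rintro _ ⟨hxF, x, rfl⟩
      refine ⟨x, hG x ?_, rfl⟩
      rw [hl] at hxF
      have : l (latticeEmb (pt x)) = l x₀ := le_antisymm (hlV _ (mem_range_self x)) (hxF.2 _ hx₀'.1)
      simp [this, hpos.ne']
    have hKfin : ((fun x => latticeEmb (pt x)) '' {x | fn G (pt x) = 1}).Finite := toFinite _
    have hFhull : convexHull ℝ (vertexSet F) = F := by
      have hc := hexp.isCompact (hfin.isCompact_convexHull ℝ)
      have := closure_convexHull_extremePoints hc (hexp.convex (convex_convexHull ℝ V))
      rwa [← vertexSet, ((hKfin.subset hsub).isClosed_convexHull ℝ).closure_eq] at this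
    have hcard : n ≤ (vertexSet F).ncard := by
      have hf := hKfin.subset hsub
      have := hf.fintype
      have hne : (vertexSet F).Nonempty := by
        rw [← convexHull_nonempty_iff (𝕜 := ℝ), hFhull]; exact ⟨x₀, hx₀⟩
      have := hne.to_subtype
      have h1 := finrank_vectorSpan_range_add_one_le ℝ (fun v : vertexSet F => (v : Fin n → ℝ))
      rw [Subtype.range_coe] at h1
      have h2 : vectorSpan ℝ (vertexSet F) = vectorSpan ℝ F := by
        rw [← direction_affineSpan, ← affineSpan_convexHull, hFhull, direction_affineSpan]
      rw [h2, hdim, ← Nat.card_eq_fintype_card] at h1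
      exact h1
    have heq : vertexSet F = (fun x => latticeEmb (pt x)) '' {x | fn G (pt x) = 1} := by
      refine eq_of_subset_of_ncard_le hsub ?_ hKfin
      refine (ncard_image_le (toFinite _)).trans ?_
      have := h.card_eq G
      rw [← Nat.card_coe_set_eq]
      exact this.le.trans hcard
    obtain ⟨b, hb⟩ := h.exists_basis G
    have e : {x // fn G (pt x) = 1} ≃ Fin n := Finite.equivFinOfCardEq (h.card_eq G)
    refine ⟨b.reindex e, ?_⟩
    rw [heq]
    ext v
    simp only [mem_image, mem_ofPred_eq, mem_range, Module.Basis.reindex_apply, hb]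
    constructor
    · rintro ⟨x, hx, rfl⟩
      exact ⟨e ⟨x, hx⟩, by simp⟩
    · rintro ⟨i, rfl⟩
      exact ⟨_, (e.symm i).2, rfl⟩

lemma ncard_vertexSet [Finite T] (h : IsFacetSystem pt fn) :
    (vertexSet (convexHull ℝ (range fun x => latticeEmb (pt x)))).ncard = Nat.card T := by
  have hinj : Function.Injective fun x => latticeEmb (pt x) :=
    latticeEmb_injective.comp h.pt_injective
  rw [h.vertexSet_eq, ← image_univ, ncard_image_of_injective _ hinj, ncard_univ]

end IsFacetSystem

/-! ### Adding a vertex: comparison of facet functionals -/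

namespace IsFacetSystem

variable {n : ℕ} {T 𝓕 : Type} {pt : T → Fin n → ℤ} {fn : 𝓕 → (Fin n → ℤ) →+ ℤ}

/-- The value of a homomorphism at a combination of the points. -/
lemma map_sum_smul [Fintype T] (g : (Fin n → ℤ) →+ ℤ) (c : T → ℤ) :
    g (∑ x, c x • pt x) = ∑ x, c x * g (pt x) := by
  simp only [map_sum, map_zsmul, smul_eq_mul]

/-- Two functionals that agree on the basis of a facet `F`, except possibly at `pt x`, differ at `w` by a
multiple of the coordinate of `w` at `pt x`. -/
lemma sub_eq_coeff_mul [Fintype T] {F : 𝓕} {w : Fin n → ℤ} {c : T → ℤ}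
    (hw : w = ∑ x, c x • pt x) (hc : ∀ x, fn F (pt x) ≠ 1 → c x = 0) (f g : (Fin n → ℤ) →+ ℤ) (x : T)
    (hfg : ∀ y ≠ x, fn F (pt y) = 1 → f (pt y) = g (pt y)) :
    f w - g w = c x * (f (pt x) - g (pt x)) := by
  rw [hw, map_sum_smul, map_sum_smul, ← Finset.sum_sub_distrib, Finset.sum_eq_single x]
  · ring
  · intro y _ hy
    by_cases hF : fn F (pt y) = 1
    · rw [hfg y hy hF, sub_self]
    · rw [hc y hF]; ring
  · simp

/-- The integral functional of a facet, extended to `ℝⁿ`. -/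
lemma exists_real_fn (fn : 𝓕 → (Fin n → ℤ) →+ ℤ) (F : 𝓕) :
    ∃ ψ : (Fin n → ℝ) →ₗ[ℝ] ℝ, ∀ w, ψ (latticeEmb w) = fn F w := by
  obtain ⟨ψ, hψ⟩ := exists_linear_extension ((Int.castAddHom ℝ).comp (fn F))
  exact ⟨ψ, fun w => by simp [hψ]⟩

variable {Q : Set (Fin n → ℝ)} {w : Fin n → ℤ}

/-- A new vertex `w` never lies on a facet hyperplane of the old polytope: otherwise that facet of the
new polytope would have more than `n` vertices. -/
lemma fn_ne_one [Fintype T] (hn : 0 < n) (h : IsFacetSystem pt fn) (hQ : IsSmoothFano Q)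
    (hV : vertexSet Q = latticeEmb '' (insert w (range pt))) (hw : w ∉ range pt) (F : 𝓕) :
    fn F w ≠ 1 := by
  intro hF
  obtain ⟨ψ, hψ⟩ := exists_real_fn fn F
  have hle : ∀ v ∈ insert w (range pt), ψ (latticeEmb v) ≤ 1 := by
    rintro v (rfl | ⟨x, rfl⟩)
    · rw [hψ, hF]; simp
    · rw [hψ]
      exact_mod_cast (h.fn_pt F x).elim le_of_eq fun h => h.trans zero_le_one
  have hspan : ∀ μ : (Fin n → ℝ) →ₗ[ℝ] ℝ, (∀ v ∈ insert w (range pt),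
      ψ (latticeEmb v) = 1 → μ (latticeEmb v) = 0) → μ = 0 := by
    intro μ hμ
    refine linear_eq_zero_of_closure (h.closure_eq_top F) ?_
    rintro _ ⟨x, hx, rfl⟩
    exact hμ _ (mem_insert_of_mem _ (mem_range_self x))
      (by rw [hψ, show fn F (pt x) = 1 from hx]; simp)
  obtain ⟨l, hl1, hl⟩ := hQ.exists_dual hn hV (ψ := ψ) (w₀ := w) hle hspan (mem_insert _ _)
    (by rw [hψ, hF]; simp)
  obtain ⟨c, hc, hc0⟩ := h.exists_coeff F w
  have : l w = 0 := by
    rw [hc, map_sum_smul]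
    refine Finset.sum_eq_zero fun x _ => ?_
    by_cases hx : fn F (pt x) = 1
    · rw [hl (pt x) (mem_insert_of_mem _ (mem_range_self x)) (by rw [hψ, hx]; simp)
        (fun h => hw (h ▸ mem_range_self x)), mul_zero]
    · rw [hc0 x hx, zero_mul]
  omega

/-- A functional that is at most `1` at all points is dominated at any given point of `ℝⁿ` by the
functional of a facet. -/
lemma exists_le_fn [Finite T] (hn : 0 < n) (h : IsFacetSystem pt fn) (x : Fin n → ℝ)
    {φ : (Fin n → ℝ) →ₗ[ℝ] ℝ} (hφ : ∀ y, φ (latticeEmb (pt y)) ≤ 1) :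
    ∃ F, ∃ ψ : (Fin n → ℝ) →ₗ[ℝ] ℝ, (∀ v, ψ (latticeEmb v) = fn F v) ∧ φ x ≤ ψ x := by
  obtain ⟨ψ, hle, hspan, hx⟩ := exists_spanning_functional (finite_range fun y => latticeEmb (pt y))
    (h.zero_mem_interior hn) x (φ := φ) (by rintro _ ⟨y, rfl⟩; exact hφ y)
  obtain ⟨F, hF⟩ := h.complete ψ fun y => hle _ (mem_range_self y)
  obtain ⟨χ, hχ⟩ := exists_real_fn fn F
  have h0 : χ - ψ = 0 := hspan _ <| by
    rintro _ ⟨y, rfl⟩ hy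
    simp only [LinearMap.sub_apply, hχ, hF y hy]
    simp [hy]
  rw [← sub_eq_zero.1 h0] at hx
  exact ⟨F, χ, hχ, hx⟩

/-- Some facet functional is positive at a given nonzero lattice point. -/
lemma exists_fn_pos [Finite T] (hn : 0 < n) (h : IsFacetSystem pt fn) {v : Fin n → ℤ} (hv : v ≠ 0) :
    ∃ F, 0 < fn F v := by
  obtain ⟨i, hi⟩ : ∃ i, v i ≠ 0 := by
    by_contra! H
    exact hv (funext H)
  -- A multiple of a coordinate functional is positive at `v` and at most `1` at all points.
  obtain ⟨N, hN⟩ := (finite_range fun y => |v i * pt y i|).bddAbove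
  have hN' : ∀ y, v i * pt y i ≤ N := fun y => (le_abs_self _).trans (hN (mem_range_self y))
  have hM : (0 : ℝ) < |(N : ℝ)| + 1 := by positivity
  obtain ⟨F, ψ, hψ, hle⟩ := h.exists_le_fn hn (latticeEmb v)
    (φ := ((v i : ℝ) / (|(N : ℝ)| + 1)) • LinearMap.proj i) fun y => by
      have h1 : (v i : ℝ) * pt y i ≤ N := by exact_mod_cast hN' y
      simp only [LinearMap.smul_apply, LinearMap.proj_apply, smul_eq_mul, latticeEmb]
      rw [div_mul_eq_mul_div, div_le_one hM]
      linarith [le_abs_self (N : ℝ)]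
  refine ⟨F, ?_⟩
  rw [hψ] at hle
  have h2 : (0 : ℝ) < (v i : ℝ) / (|(N : ℝ)| + 1) * v i := by
    rw [div_mul_eq_mul_div]
    have : (0 : ℝ) < v i * v i := by
      have : (v i : ℝ) ≠ 0 := by exact_mod_cast hi
      exact mul_self_pos.2 this
    positivity
  have h3 : (0 : ℝ) < fn F v := h2.trans_le (by simpa [latticeEmb] using hle)
  exact_mod_cast h3

lemma exists_fn_nonpos [Finite T] (hn : 0 < n) (h : IsFacetSystem pt fn) (v : Fin n → ℤ) :
    ∃ F, fn F v ≤ 0 := by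
  obtain ⟨F, ψ, hψ, hle⟩ := h.exists_le_fn hn (-latticeEmb v) (φ := 0) fun y => by simp
  refine ⟨F, ?_⟩
  rw [map_neg ψ, hψ, LinearMap.zero_apply, le_neg, neg_zero] at hle
  exact_mod_cast hle

/-- A new vertex lies strictly beyond some facet of the old polytope. -/
lemma exists_two_le [Finite T] (hn : 0 < n) (h : IsFacetSystem pt fn)
    (hV : vertexSet Q = latticeEmb '' (insert w (range pt))) (hQ : IsSmoothFano Q)
    (hw : w ∉ range pt) : ∃ F, 2 ≤ fn F w := by
  set V := range fun x => latticeEmb (pt x) with hVdef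
  have hwV : latticeEmb w ∉ convexHull ℝ V := fun hmem => by
    have hsub : convexHull ℝ V ⊆ Q := by
      rw [← hQ.1.convexHull_vertexSet, hV]
      refine convexHull_mono ?_
      rintro _ ⟨x, rfl⟩
      exact mem_image_of_mem _ (mem_insert_of_mem _ (mem_range_self x))
    have h1 : latticeEmb w ∈ vertexSet Q := hV ▸ mem_image_of_mem _ (mem_insert _ _)
    have h2 := inter_extremePoints_subset_extremePoints_of_subset hsub ⟨hmem, h1⟩
    obtain ⟨x, hx⟩ := extremePoints_convexHull_subset h2
    exact hw ⟨x, latticeEmb_injective hx⟩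
  obtain ⟨f, u, hf, hu⟩ := geometric_hahn_banach_closed_point (convex_convexHull ℝ V)
    ((finite_range _).isClosed_convexHull ℝ) hwV
  have hu0 : 0 < u := by
    have := hf 0 (interior_subset (h.zero_mem_interior hn))
    rwa [map_zero] at this
  obtain ⟨F, ψ, hψ, hle⟩ := h.exists_le_fn hn (latticeEmb w)
    (φ := u⁻¹ • (f : (Fin n → ℝ) →ₗ[ℝ] ℝ)) fun y => by
      have := hf _ (subset_convexHull ℝ V (mem_range_self y))
      simp only [LinearMap.smul_apply, smul_eq_mul, ContinuousLinearMap.coe_coe]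
      rw [inv_mul_le_iff₀ hu0, mul_one]
      exact this.le
  refine ⟨F, ?_⟩
  rw [hψ] at hle
  have h3 : (1 : ℝ) < u⁻¹ * f (latticeEmb w) := by
    rwa [lt_inv_mul_iff₀ hu0, mul_one]
  have h4 : (1 : ℝ) < fn F w := h3.trans_le (by simpa using hle)
  have h5 : (1 : ℤ) < fn F w := by exact_mod_cast h4
  omega

/-- Let `F` and `F'` be adjacent facets of the old polytope, `pt x` the vertex of `F` that is not in `F'`.
If the new vertex `w` lies beyond `F` but not beyond `F'`, then the common ridge and `w` span a facet of
the new polytope, so that `w` has coordinate `1` at `pt x`. -/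
lemma coeff_eq_one [Fintype T] (hn : 0 < n) (h : IsFacetSystem pt fn) (hQ : IsSmoothFano Q)
    (hV : vertexSet Q = latticeEmb '' (insert w (range pt))) (hw : w ∉ range pt) {F F' : 𝓕}
    (hF : 2 ≤ fn F w) (hF' : fn F' w ≤ 0) {x : T} (hx : fn F (pt x) = 1)
    (hsub : ∀ y ≠ x, fn F (pt y) = 1 → fn F' (pt y) = 1) {c : T → ℤ} (hc : w = ∑ x, c x • pt x)
    (hc0 : ∀ x, fn F (pt x) ≠ 1 → c x = 0) : c x = 1 := by
  have hdiff := sub_eq_coeff_mul hc hc0 (fn F) (fn F') x fun y hy h1 => h1.trans (hsub y hy h1).symm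
  rw [hx] at hdiff
  have hd : 0 ≤ 1 - fn F' (pt x) := by rcases h.fn_pt F' x with h1 | h1 <;> omega
  have hcpos : 0 < c x := by
    by_contra! hneg
    have := mul_nonpos_of_nonpos_of_nonneg hneg hd
    omega
  obtain ⟨ψ₁, hψ₁⟩ := exists_real_fn fn F
  obtain ⟨ψ₂, hψ₂⟩ := exists_real_fn fn F'
  -- The weights of the convex combination of the two functionals that takes the value `1` at `w`.
  obtain ⟨A, hA⟩ : ∃ A : ℝ, A = fn F w := ⟨_, rfl⟩
  obtain ⟨B, hB⟩ : ∃ B : ℝ, B = fn F' w := ⟨_, rfl⟩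
  have hA2 : (2 : ℝ) ≤ A := by rw [hA]; exact_mod_cast hF
  have hB0 : B ≤ 0 := by rw [hB]; exact_mod_cast hF'
  have hAB : 0 < A - B := by linarith
  set s : ℝ := (1 - B) / (A - B) with hs
  set t : ℝ := (A - 1) / (A - B) with ht
  have hs0 : 0 ≤ s := div_nonneg (by linarith) hAB.le
  have ht0 : 0 ≤ t := div_nonneg (by linarith) hAB.le
  have hst : s + t = 1 := by rw [hs, ht, ← add_div]; field_simp; ring
  set ψ := s • ψ₁ + t • ψ₂ with hψdef
  have hψ : ∀ v, ψ (latticeEmb v) = s * fn F v + t * fn F' v := fun v => by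
    simp [hψdef, hψ₁, hψ₂]
  have hψw : ψ (latticeEmb w) = 1 := by
    rw [hψ, ← hA, ← hB, hs, ht, div_mul_eq_mul_div, div_mul_eq_mul_div, ← add_div]
    rw [div_eq_one_iff_eq hAB.ne']
    ring
  have hridge : ∀ y ≠ x, fn F (pt y) = 1 → ψ (latticeEmb (pt y)) = 1 := fun y hy h1 => by
    rw [hψ, h1, hsub y hy h1]
    simpa using hst
  have hle : ∀ v ∈ insert w (range pt), ψ (latticeEmb v) ≤ 1 := by
    rintro v (rfl | ⟨y, rfl⟩)
    · exact hψw.le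
    · have h1 : (fn F (pt y) : ℝ) ≤ 1 := by
        exact_mod_cast (h.fn_pt F y).elim le_of_eq fun h => h.trans zero_le_one
      have h2 : (fn F' (pt y) : ℝ) ≤ 1 := by
        exact_mod_cast (h.fn_pt F' y).elim le_of_eq fun h => h.trans zero_le_one
      rw [hψ, ← hst]
      nlinarith
  have hspan : ∀ μ : (Fin n → ℝ) →ₗ[ℝ] ℝ, (∀ v ∈ insert w (range pt),
      ψ (latticeEmb v) = 1 → μ (latticeEmb v) = 0) → μ = 0 := by
    intro μ hμ
    have hr : ∀ y ≠ x, fn F (pt y) = 1 → μ (latticeEmb (pt y)) = 0 := fun y hy h1 =>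
      hμ _ (mem_insert_of_mem _ (mem_range_self y)) (hridge y hy h1)
    have hμw : μ (latticeEmb w) = c x * μ (latticeEmb (pt x)) := by
      conv_lhs => rw [hc, ← latticeHom_apply, map_sum, map_sum]
      rw [Finset.sum_eq_single x]
      · rw [map_zsmul, map_zsmul, latticeHom_apply, zsmul_eq_mul]
      · intro y _ hy
        by_cases hFy : fn F (pt y) = 1
        · rw [map_zsmul, map_zsmul, latticeHom_apply, hr y hy hFy, smul_zero]
        · rw [hc0 y hFy, zero_smul, map_zero, map_zero]
      · simp
    rw [hμ w (mem_insert _ _) hψw] at hμw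
    have hμx : μ (latticeEmb (pt x)) = 0 :=
      (mul_eq_zero.1 hμw.symm).resolve_left (by exact_mod_cast hcpos.ne')
    refine linear_eq_zero_of_closure (h.closure_eq_top F) ?_
    rintro _ ⟨y, hy, rfl⟩
    by_cases hyx : y = x
    · rw [hyx, hμx]
    · exact hr y hyx hy
  obtain ⟨l, hl1, hl⟩ := hQ.exists_dual hn hV (ψ := ψ) (w₀ := w) hle hspan (mem_insert _ _) hψw
  have h1 : l w = c x * l (pt x) := by
    conv_lhs => rw [hc, map_sum_smul]
    refine Finset.sum_eq_single x (fun y _ hy => ?_) (by simp)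
    by_cases hFy : fn F (pt y) = 1
    · rw [hl (pt y) (mem_insert_of_mem _ (mem_range_self y)) (hridge y hy hFy)
        (fun h => hw (h ▸ mem_range_self y)), mul_zero]
    · rw [hc0 y hFy, zero_mul]
  rw [hl1] at h1
  exact Int.eq_one_of_mul_eq_one_right hcpos.le h1.symm

/-- Being beyond a facet passes to every adjacent facet `F'` across a ridge of degree one, that is, if the
functional of `F'` vanishes at the vertex of `F` that is not in `F'`. -/
lemma two_le_of_adjacent [Fintype T] (hn : 0 < n) (h : IsFacetSystem pt fn) (hQ : IsSmoothFano Q)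
    (hV : vertexSet Q = latticeEmb '' (insert w (range pt))) (hw : w ∉ range pt) {F F' : 𝓕}
    (hF : 2 ≤ fn F w) (x : T) (hx : fn F' (pt x) = 0)
    (hsub : ∀ y ≠ x, fn F (pt y) = 1 → fn F' (pt y) = 1) : 2 ≤ fn F' w := by
  by_contra! hlt
  have hne := h.fn_ne_one hn hQ hV hw F'
  obtain ⟨c, hc, hc0⟩ := h.exists_coeff F w
  have hdiff := sub_eq_coeff_mul hc hc0 (fn F) (fn F') x fun y hy h1 => h1.trans (hsub y hy h1).symm
  by_cases hFx : fn F (pt x) = 1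
  · rw [h.coeff_eq_one hn hQ hV hw hF (by omega) hFx hsub hc hc0] at hdiff
    omega
  · rw [hc0 x hFx] at hdiff
    omega

end IsFacetSystem

/-! ### The vertices and facet functionals of the family -/

/-- The index set of the vertices: `t`, `z` and the blocks `y`, `u`, `v` and `x i`, of sizes `p + 1`,
`p + 1`, `q + 2` and `d i + 1`. -/
inductive Vtx (p q : ℕ) {ι : Type} (d : ι → ℕ) : Type
  | t : Vtx p q d
  | z : Vtx p q d
  | y (j : Fin (p + 1)) : Vtx p q d
  | u (j : Fin (p + 1)) : Vtx p q d
  | v (a : Fin (q + 2)) : Vtx p q d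
  | x (i : ι) (k : Fin (d i + 1)) : Vtx p q d

/-- The index sets of the blocks, joined into one sum type. -/
def vtxEquiv (p q : ℕ) {ι : Type} (d : ι → ℕ) :
    Vtx p q d ≃ (Unit ⊕ Unit) ⊕ (Fin (p + 1) ⊕ Fin (p + 1)) ⊕ Fin (q + 2) ⊕ Σ i, Fin (d i + 1) where
  toFun
    | .t => .inl (.inl ())
    | .z => .inl (.inr ())
    | .y j => .inr (.inl (.inl j))
    | .u j => .inr (.inl (.inr j))
    | .v a => .inr (.inr (.inl a))
    | .x i k => .inr (.inr (.inr ⟨i, k⟩))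
  invFun
    | .inl (.inl _) => .t
    | .inl (.inr _) => .z
    | .inr (.inl (.inl j)) => .y j
    | .inr (.inl (.inr j)) => .u j
    | .inr (.inr (.inl a)) => .v a
    | .inr (.inr (.inr ⟨i, k⟩)) => .x i k
  left_inv x := by cases x <;> rfl
  right_inv x := by rcases x with (_ | _) | (_ | _) | _ | _ <;> rfl

instance {p q : ℕ} {ι : Type} [Fintype ι] {d : ι → ℕ} : Fintype (Vtx p q d) :=
  Fintype.ofEquiv _ (vtxEquiv p q d).symm

lemma sum_vtx {p q : ℕ} {ι : Type} [Fintype ι] {d : ι → ℕ} {M : Type} [AddCommMonoid M]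
    (f : Vtx p q d → M) :
    ∑ x, f x = (f .t + f .z) + ((∑ j, f (.y j) + ∑ j, f (.u j)) +
      (∑ a, f (.v a) + ∑ i, ∑ k, f (.x i k))) := by
  rw [← Equiv.sum_comp (vtxEquiv p q d).symm]
  simp only [Fintype.sum_sum_type, Fintype.sum_sigma]
  simp [vtxEquiv]

/-- The degree of the block `x i`, whose vertices sum to the combination of the `y j` and `u j` with
coefficients `α i j` and `β i j`. -/
def blockDeg {p : ℕ} {ι : Type} (α β : ι → Fin (p + 1) → ℕ) (i : ι) : ℕ := ∑ j, α i j + ∑ j, β i j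

/-- The linear relations between the vertices. -/
structure VtxRel {p q : ℕ} {ι : Type} (α β : ι → Fin (p + 1) → ℕ) {M : Type} [AddCommGroup M]
    (f : Vtx p q (blockDeg α β) → M) : Prop where
  tz : f .t + f .z = 0
  yu : ∑ j, f (.y j) + f .z = ∑ j, f (.u j)
  vy : ∑ a, f (.v a) + ∑ j, f (.y j) = (p + q + 2) • f .t
  x : ∀ i, ∑ k, f (.x i k) = ∑ j, α i j • f (.y j) + ∑ j, β i j • f (.u j)

/-- The vertices outside the blocks `x i` that a facet contains: all of `t`, `z`, `y`, `u`, `v` except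
three. The constructors name the two of the three that are not `t` or `z` or, for `nv`, the one; the third
one is `z` for `tv` and `ty`, and `t` for `zv` and `zu`. -/
inductive CoreFacet (p q : ℕ) : Type
  | tv (j : Fin (p + 1)) (a : Fin (q + 2)) : CoreFacet p q
  | ty (j k : Fin (p + 1)) : CoreFacet p q
  | zv (j : Fin (p + 1)) (a : Fin (q + 2)) : CoreFacet p q
  | zu (j k : Fin (p + 1)) : CoreFacet p q
  | nv (a : Fin (q + 2)) : CoreFacet p q

/-- The values at the vertices of the functional of a facet. The facet contains, of each block `x i`, all
vertices except the one with index `σ i`. -/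
def facetVal {p q : ℕ} {ι : Type} (α β : ι → Fin (p + 1) → ℕ) :
    CoreFacet p q → (∀ i, Fin (blockDeg α β i + 1)) → Vtx p q (blockDeg α β) → ℤ
  | .tv _ _, _, .t => 1
  | .tv _ _, _, .z => -1
  | .tv _ _, _, .y _ => 1
  | .tv j _, _, .u l => if l = j then 0 else 1
  | .tv _ a, _, .v c => if c = a then 0 else 1
  | .tv j _, σ, .x i k => if k = σ i then -β i j else 1
  | .ty _ _, _, .t => 1
  | .ty _ _, _, .z => -1
  | .ty _ k, _, .y l => if l = k then 0 else 1
  | .ty j _, _, .u l => if l = j then -1 else 1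
  | .ty _ _, _, .v _ => 1
  | .ty j k, σ, .x i l => if l = σ i then -(α i k + 2 * β i j) else 1
  | .zv _ _, _, .t => -1
  | .zv _ _, _, .z => 1
  | .zv j _, _, .y l => if l = j then 0 else 1
  | .zv _ _, _, .u _ => 1
  | .zv _ a, _, .v c => if c = a then -(2 * p + 2 * q + 3) else 1
  | .zv j _, σ, .x i k => if k = σ i then -α i j else 1
  | .zu _ _, _, .t => -1
  | .zu _ _, _, .z => 1
  | .zu j _, _, .y l => if l = j then -(2 * p + 2 * q + 4) else 1
  | .zu _ k, _, .u l => if l = k then -(2 * p + 2 * q + 3) else 1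
  | .zu _ _, _, .v _ => 1
  | .zu j k, σ, .x i l =>
      if l = σ i then -((2 * p + 2 * q + 5) * α i j + (2 * p + 2 * q + 4) * β i k) else 1
  | .nv _, _, .t => 0
  | .nv _, _, .z => 0
  | .nv _, _, .y _ => 1
  | .nv _, _, .u _ => 1
  | .nv a, _, .v c => if c = a then -(p + q + 2) else 1
  | .nv _, σ, .x i k => if k = σ i then 0 else 1

lemma sum_ite_one {m : ℕ} (j : Fin (m + 1)) (c : ℤ) : ∑ l, (if l = j then c else 1) = m + c := by
  have : ∀ l, (if l = j then c else 1) = 1 + if l = j then c - 1 else 0 := fun l => by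
    split_ifs <;> ring
  simp only [this, Finset.sum_add_distrib, Finset.sum_ite_eq', Finset.mem_univ, if_true]
  simp

lemma sum_mul_ite_one {m : ℕ} (a : Fin (m + 1) → ℕ) (j : Fin (m + 1)) (c : ℤ) :
    ∑ l, (a l : ℤ) * (if l = j then c else 1) = ∑ l, (a l : ℤ) + a j * (c - 1) := by
  have : ∀ l, (a l : ℤ) * (if l = j then c else 1) = a l + if l = j then a l * (c - 1) else 0 :=
    fun l => by split_ifs <;> ring
  simp [this, Finset.sum_add_distrib]

lemma rel_facetVal {p q : ℕ} {ι : Type} (α β : ι → Fin (p + 1) → ℕ) (F : CoreFacet p q)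
    (σ : ∀ i, Fin (blockDeg α β i + 1)) : VtxRel α β (facetVal α β F σ) := by
  cases F <;> constructor <;> (try intro i) <;>
    simp only [facetVal, sum_ite_one, sum_mul_ite_one, nsmul_eq_mul, Finset.sum_const,
      Finset.card_univ, Fintype.card_fin, mul_one] <;> (try simp only [blockDeg]) <;> push_cast <;>
    ring

lemma facetVal_eq_one_or_nonpos {p q : ℕ} {ι : Type} (α β : ι → Fin (p + 1) → ℕ)
    (F : CoreFacet p q) (σ : ∀ i, Fin (blockDeg α β i + 1)) (x : Vtx p q (blockDeg α β)) :
    facetVal α β F σ x = 1 ∨ facetVal α β F σ x ≤ 0 := by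
  have key : ∀ (P : Prop) [Decidable P] (c : ℤ), 0 ≤ -c →
      (if P then c else 1) = 1 ∨ (if P then c else 1) ≤ 0 := fun P _ c hc => by
    split_ifs <;> omega
  cases F <;> cases x <;> simp only [facetVal] <;>
    first | (refine key _ _ ?_; rw [neg_neg]; positivity) | (refine key _ _ ?_; simp) | simp

lemma card_facetVal_eq_one {p q : ℕ} {ι : Type} [Fintype ι] (α β : ι → Fin (p + 1) → ℕ)
    (F : CoreFacet p q) (σ : ∀ i, Fin (blockDeg α β i + 1)) :
    Nat.card {x // facetVal α β F σ x = 1} = 2 * p + q + 3 + ∑ i, blockDeg α β i := by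
  obtain ⟨I, hI⟩ : ∃ I : ℤ → ℤ, ∀ c, I c = if c = 1 then 1 else 0 := ⟨_, fun _ => rfl⟩
  have key : ∀ (P : Prop) [Decidable P] (c : ℤ), 0 ≤ c →
      I (if P then -c else 1) = if P then 0 else 1 := fun P _ c hc => by
    rw [hI]; split_ifs <;> first | rfl | omega
  have key0 : ∀ (P : Prop) [Decidable P], I (if P then 0 else 1) = if P then 0 else 1 :=
    fun P _ => by simpa using key P 0 le_rfl
  have hI1 : I 1 = 1 := by simp [hI]
  have hI0 : I 0 = 0 := by simp [hI]
  have hIn : I (-1) = 0 := by simp [hI]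
  have h1 : (Nat.card {x // facetVal α β F σ x = 1} : ℤ) = ∑ x, I (facetVal α β F σ x) := by
    rw [Nat.card_eq_fintype_card, Fintype.card_subtype]
    simp [hI]
  zify
  rw [h1, sum_vtx]
  cases F <;> simp only [facetVal, key0, hI1, hI0, hIn] <;>
    simp (discharger := positivity) only [key, sum_ite_one, Finset.sum_const, Finset.card_univ,
      Fintype.card_fin, nsmul_eq_mul] <;> simp <;> ring

lemma mem_of_sum_mem {M κ : Type} [AddCommGroup M] [Fintype κ] (H : AddSubgroup M)
    {f : κ → M} (j : κ) (hs : ∑ l, f l ∈ H) (h : ∀ l ≠ j, f l ∈ H) : f j ∈ H := by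
  classical
  rw [← Finset.add_sum_erase _ _ (Finset.mem_univ j)] at hs
  exact (H.add_mem_cancel_right
    (H.sum_mem fun l hl => h l (Finset.ne_of_mem_erase hl))).1 hs

/-! ### Realizations of the relations by lattice points -/

/-- The relations express every vertex in terms of the vertices of any facet. -/
lemma VtxRel.mem_of_facet {p q : ℕ} {ι : Type} {α β : ι → Fin (p + 1) → ℕ} {M : Type}
    [AddCommGroup M] {f : Vtx p q (blockDeg α β) → M} (hf : VtxRel α β f) (H : AddSubgroup M)
    (F : CoreFacet p q) (σ : ∀ i, Fin (blockDeg α β i + 1))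
    (hH : ∀ x, facetVal α β F σ x = 1 → f x ∈ H) (x : Vtx p q (blockDeg α β)) : f x ∈ H := by
  have hz' : f .z = -f .t := (neg_eq_of_add_eq_zero_right hf.tz).symm
  have hsum : ∀ {m : ℕ} (g : Fin m → M), (∀ l, g l ∈ H) → ∑ l, g l ∈ H :=
    fun g hg => H.sum_mem fun l _ => hg l
  have hvy : f .t ∈ H → ∑ a, f (.v a) + ∑ j, f (.y j) ∈ H := fun ht => by
    rw [hf.vy]; exact H.nsmul_mem ht _
  have hcore : f .t ∈ H ∧ f .z ∈ H ∧ (∀ j, f (.y j) ∈ H) ∧ (∀ j, f (.u j) ∈ H) ∧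
      ∀ a, f (.v a) ∈ H := by
    cases F with
    | tv j a =>
      have ht : f .t ∈ H := hH _ rfl
      have hz : f .z ∈ H := hz' ▸ H.neg_mem ht
      have hy : ∀ l, f (.y l) ∈ H := fun l => hH _ rfl
      have hu' : ∑ l, f (.u l) ∈ H := hf.yu ▸ H.add_mem (hsum _ hy) hz
      have hv' : ∑ c, f (.v c) ∈ H := (H.add_mem_cancel_right (hsum _ hy)).1 (hvy ht)
      refine ⟨ht, hz, hy, fun l => ?_, fun c => ?_⟩
      · by_cases hl : l = j
        · exact hl ▸ mem_of_sum_mem H j hu' fun k hk => hH _ (by simp [facetVal, hk])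
        · exact hH _ (by simp [facetVal, hl])
      · by_cases hc : c = a
        · exact hc ▸ mem_of_sum_mem H a hv' fun k hk => hH _ (by simp [facetVal, hk])
        · exact hH _ (by simp [facetVal, hc])
    | ty j k =>
      have ht : f .t ∈ H := hH _ rfl
      have hz : f .z ∈ H := hz' ▸ H.neg_mem ht
      have hv : ∀ c, f (.v c) ∈ H := fun c => hH _ rfl
      have hy' : ∑ l, f (.y l) ∈ H := (H.add_mem_cancel_left (hsum _ hv)).1 (hvy ht)
      have hu' : ∑ l, f (.u l) ∈ H := hf.yu ▸ H.add_mem hy' hz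
      refine ⟨ht, hz, fun l => ?_, fun l => ?_, hv⟩
      · by_cases hl : l = k
        · exact hl ▸ mem_of_sum_mem H k hy' fun k hk => hH _ (by simp [facetVal, hk])
        · exact hH _ (by simp [facetVal, hl])
      · by_cases hl : l = j
        · exact hl ▸ mem_of_sum_mem H j hu' fun k hk => hH _ (by simp [facetVal, hk])
        · exact hH _ (by simp [facetVal, hl])
    | zv j a =>
      have hz : f .z ∈ H := hH _ rfl
      have ht : f .t ∈ H := by
        rw [hz'] at hz; exact H.neg_mem_iff.1 hz
      have hu : ∀ l, f (.u l) ∈ H := fun l => hH _ rfl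
      have hy' : ∑ l, f (.y l) ∈ H := (H.add_mem_cancel_right hz).1 (hf.yu ▸ hsum _ hu)
      have hv' : ∑ c, f (.v c) ∈ H := (H.add_mem_cancel_right hy').1 (hvy ht)
      refine ⟨ht, hz, fun l => ?_, hu, fun c => ?_⟩
      · by_cases hl : l = j
        · exact hl ▸ mem_of_sum_mem H j hy' fun k hk => hH _ (by simp [facetVal, hk])
        · exact hH _ (by simp [facetVal, hl])
      · by_cases hc : c = a
        · exact hc ▸ mem_of_sum_mem H a hv' fun k hk => hH _ (by simp [facetVal, hk])
        · exact hH _ (by simp [facetVal, hc])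
    | zu j k =>
      have hz : f .z ∈ H := hH _ rfl
      have ht : f .t ∈ H := by
        rw [hz'] at hz; exact H.neg_mem_iff.1 hz
      have hv : ∀ c, f (.v c) ∈ H := fun c => hH _ rfl
      have hy' : ∑ l, f (.y l) ∈ H := (H.add_mem_cancel_left (hsum _ hv)).1 (hvy ht)
      have hu' : ∑ l, f (.u l) ∈ H := hf.yu ▸ H.add_mem hy' hz
      refine ⟨ht, hz, fun l => ?_, fun l => ?_, hv⟩
      · by_cases hl : l = j
        · exact hl ▸ mem_of_sum_mem H j hy' fun k hk => hH _ (by simp [facetVal, hk])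
        · exact hH _ (by simp [facetVal, hl])
      · by_cases hl : l = k
        · exact hl ▸ mem_of_sum_mem H k hu' fun k hk => hH _ (by simp [facetVal, hk])
        · exact hH _ (by simp [facetVal, hl])
    | nv a =>
      have hy : ∀ l, f (.y l) ∈ H := fun l => hH _ rfl
      have hu : ∀ l, f (.u l) ∈ H := fun l => hH _ rfl
      have hz : f .z ∈ H := (H.add_mem_cancel_left (hsum _ hy)).1 (hf.yu ▸ hsum _ hu)
      have ht : f .t ∈ H := by
        rw [hz'] at hz; exact H.neg_mem_iff.1 hz
      have hv' : ∑ c, f (.v c) ∈ H := (H.add_mem_cancel_right (hsum _ hy)).1 (hvy ht)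
      refine ⟨ht, hz, hy, hu, fun c => ?_⟩
      by_cases hc : c = a
      · exact hc ▸ mem_of_sum_mem H a hv' fun k hk => hH _ (by simp [facetVal, hk])
      · exact hH _ (by simp [facetVal, hc])
  obtain ⟨ht, hz, hy, hu, hv⟩ := hcore
  cases x with
  | t => exact ht
  | z => exact hz
  | y j => exact hy j
  | u j => exact hu j
  | v a => exact hv a
  | x i k =>
    have hx : ∀ l ≠ σ i, f (.x i l) ∈ H := fun l hl => hH _ (by cases F <;> simp [facetVal, hl])
    by_cases hk : k = σ i
    · subst hk
      refine mem_of_sum_mem H (f := fun l => f (.x i l)) (σ i) ?_ hx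
      rw [hf.x i]
      exact H.add_mem (hsum _ fun j => H.nsmul_mem (hy j) _) (hsum _ fun j => H.nsmul_mem (hu j) _)
    · exact hx k hk

/-- Numbers `≤ 1` whose sum is less than their number are not all equal to `1`. -/
lemma exists_ne_one_of_sum_lt {m : ℕ} {g : Fin m → ℝ} (h : ∑ l, g l < m) : ∃ l, g l ≠ 1 := by
  by_contra! H
  simp [H] at h

lemma sum_le_of_le_one {m : ℕ} {g : Fin m → ℝ} (h : ∀ l, g l ≤ 1) : ∑ l, g l ≤ m := by
  simpa using Finset.sum_le_card_nsmul Finset.univ g 1 fun l _ => h l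

/-- The equality set of a functional that is at most `1` at all vertices contains none of the sets of
vertices `{t, z}`, `y ∪ {z}`, `u ∪ {t}`, `v ∪ y`, `u ∪ v` and `x i`, because these have sums that the
relations write with fewer vertices. Therefore it is contained in a facet. -/
lemma VtxRel.exists_facet {p q : ℕ} {ι : Type} {α β : ι → Fin (p + 1) → ℕ}
    {f : Vtx p q (blockDeg α β) → ℝ} (hf : VtxRel α β f) (hle : ∀ x, f x ≤ 1) :
    ∃ F σ, ∀ x, f x = 1 → facetVal α β F σ x = 1 := by
  have hx : ∀ i, ∃ k, f (.x i k) ≠ 1 := fun i => by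
    refine exists_ne_one_of_sum_lt ?_
    have h1 : ∑ j, α i j • f (.y j) ≤ ∑ j, (α i j : ℝ) := Finset.sum_le_sum fun j _ => by
      rw [nsmul_eq_mul]; exact mul_le_of_le_one_right (Nat.cast_nonneg _) (hle _)
    have h2 : ∑ j, β i j • f (.u j) ≤ ∑ j, (β i j : ℝ) := Finset.sum_le_sum fun j _ => by
      rw [nsmul_eq_mul]; exact mul_le_of_le_one_right (Nat.cast_nonneg _) (hle _)
    rw [hf.x i]
    push_cast [blockDeg]
    linarith
  choose σ hσ using hx
  have htz := hf.tz
  have hyu := hf.yu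
  have hvy := hf.vy
  rw [nsmul_eq_mul] at hvy
  push_cast at hvy
  have hY := sum_le_of_le_one fun j => hle (.y j)
  have hU := sum_le_of_le_one fun j => hle (.u j)
  have hV := sum_le_of_le_one fun j => hle (.v j)
  have hp : (0 : ℝ) ≤ p := Nat.cast_nonneg p
  have hq : (0 : ℝ) ≤ q := Nat.cast_nonneg q
  push_cast at hY hU hV
  -- In each case below, all values at `v` and `y`, or all values at `v` and `u`, cannot be `1`.
  have hvy' : (∃ a, f (.v a) ≠ 1) ∨ ∃ k, f (.y k) ≠ 1 := by
    by_contra! H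
    simp only [H.1, H.2, Finset.sum_const, Finset.card_univ, Fintype.card_fin, nsmul_eq_mul,
      mul_one] at hvy
    push_cast at hvy
    nlinarith [hle .t]
  have hvu' : (∃ a, f (.v a) ≠ 1) ∨ ∃ k, f (.u k) ≠ 1 := by
    by_contra! H
    simp only [H.1, H.2, Finset.sum_const, Finset.card_univ, Fintype.card_fin, nsmul_eq_mul,
      mul_one] at hvy hyu
    push_cast at hvy hyu
    nlinarith [hle .t]
  by_cases ht : f .t = 1
  · obtain ⟨j, hj⟩ : ∃ j, f (.u j) ≠ 1 := exists_ne_one_of_sum_lt (by push_cast; linarith)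
    rcases hvy' with ⟨a, ha⟩ | ⟨k, hk⟩
    · refine ⟨.tv j a, σ, fun x h => ?_⟩
      cases x <;> simp only [facetVal] <;> (try split_ifs) <;> try rfl
      all_goals first | (subst_vars; contradiction) | (subst_vars; exact absurd h (hσ _)) | (exfalso; linarith)
    · refine ⟨.ty j k, σ, fun x h => ?_⟩
      cases x <;> simp only [facetVal] <;> (try split_ifs) <;> try rfl
      all_goals first | (subst_vars; contradiction) | (subst_vars; exact absurd h (hσ _)) | (exfalso; linarith)
  by_cases hz : f .z = 1
  · obtain ⟨j, hj⟩ : ∃ j, f (.y j) ≠ 1 := exists_ne_one_of_sum_lt (by push_cast; linarith)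
    rcases hvu' with ⟨a, ha⟩ | ⟨k, hk⟩
    · refine ⟨.zv j a, σ, fun x h => ?_⟩
      cases x <;> simp only [facetVal] <;> (try split_ifs) <;> try rfl
      all_goals first | (subst_vars; contradiction) | (subst_vars; exact absurd h (hσ _))
    · refine ⟨.zu j k, σ, fun x h => ?_⟩
      cases x <;> simp only [facetVal] <;> (try split_ifs) <;> try rfl
      all_goals first | (subst_vars; contradiction) | (subst_vars; exact absurd h (hσ _))
  by_cases hv : ∃ a, f (.v a) ≠ 1
  · obtain ⟨a, ha⟩ := hv
    refine ⟨.nv a, σ, fun x h => ?_⟩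
    cases x <;> simp only [facetVal] <;> (try split_ifs) <;> try rfl
    all_goals first | (subst_vars; contradiction) | (subst_vars; exact absurd h (hσ _))
  · obtain ⟨j, hj⟩ := hvy'.resolve_left hv
    obtain ⟨k, hk⟩ := hvu'.resolve_left hv
    refine ⟨.zu j k, σ, fun x h => ?_⟩
    cases x <;> simp only [facetVal] <;> (try split_ifs) <;> try rfl
    all_goals first | (subst_vars; contradiction) | (subst_vars; exact absurd h (hσ _))

lemma VtxRel.eq_zero_of_nonpos {p q : ℕ} {ι : Type} {α β : ι → Fin (p + 1) → ℕ}
    {f : Vtx p q (blockDeg α β) → ℝ} (hf : VtxRel α β f) (hle : ∀ x, f x ≤ 0)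
    (x : Vtx p q (blockDeg α β)) : f x = 0 := by
  have hzero : ∀ {m : ℕ} (g : Fin m → ℝ), (∀ l, g l ≤ 0) → 0 ≤ ∑ l, g l → ∀ l, g l = 0 :=
    fun g hg h l => (Finset.sum_eq_zero_iff_of_nonpos fun l _ => hg l).1
      (le_antisymm (Finset.sum_nonpos fun l _ => hg l) h) l (Finset.mem_univ l)
  have htz := hf.tz
  have ht : f .t = 0 := by linarith [hle .t, hle .z]
  have hz : f .z = 0 := by linarith [hle .t, hle .z]
  have hvy := hf.vy
  rw [ht, smul_zero] at hvy
  have hyu := hf.yu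
  have h1 : ∑ a, f (.v a) ≤ 0 := Finset.sum_nonpos fun a _ => hle _
  have h2 : ∑ j, f (.y j) ≤ 0 := Finset.sum_nonpos fun a _ => hle _
  have hy : ∀ j, f (.y j) = 0 := hzero _ (fun _ => hle _) (by linarith)
  have hv : ∀ a, f (.v a) = 0 := hzero _ (fun _ => hle _) (by linarith)
  have hu : ∀ j, f (.u j) = 0 := hzero _ (fun _ => hle _) (by linarith)
  cases x with
  | t => exact ht
  | z => exact hz
  | y j => exact hy j
  | u j => exact hu j
  | v a => exact hv a
  | x i k => exact hzero (fun k => f (.x i k)) (fun _ => hle _) (by simp [hf.x i, hy, hu]) k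

/-- Points of `ℤⁿ` that generate `ℤⁿ` subject to the relations of the vertices only. -/
structure IsRealization {p q : ℕ} {ι : Type} (α β : ι → Fin (p + 1) → ℕ) {n : ℕ}
    (e : Vtx p q (blockDeg α β) → Fin n → ℤ) : Prop where
  rel : VtxRel α β e
  closure_eq_top : AddSubgroup.closure (range e) = ⊤
  lift : ∀ {M : Type} [AddCommGroup M] (f : Vtx p q (blockDeg α β) → M), VtxRel α β f →
    ∃ g : (Fin n → ℤ) →+ M, ∀ x, g (e x) = f x

lemma VtxRel.map {p q : ℕ} {ι : Type} {α β : ι → Fin (p + 1) → ℕ} {M N : Type}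
    [AddCommGroup M] [AddCommGroup N] {f : Vtx p q (blockDeg α β) → M} (hf : VtxRel α β f)
    (g : M →+ N) : VtxRel α β fun x => g (f x) where
  tz := by rw [← map_add, hf.tz, map_zero]
  yu := by rw [← map_sum, ← map_sum, ← map_add, hf.yu]
  vy := by rw [← map_sum, ← map_sum, ← map_add, hf.vy, map_nsmul]
  x i := by simp only [← map_sum, ← map_add, ← map_nsmul, hf.x]

namespace IsRealization

variable {p q : ℕ} {ι : Type} {α β : ι → Fin (p + 1) → ℕ} {n : ℕ}
  {e : Vtx p q (blockDeg α β) → Fin n → ℤ}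

lemma rel_linear (he : IsRealization α β e) (ψ : (Fin n → ℝ) →ₗ[ℝ] ℝ) :
    VtxRel α β fun x => ψ (latticeEmb (e x)) :=
  he.rel.map (ψ.toAddMonoidHom.comp (latticeHom n))

lemma exists_linear (he : IsRealization α β e) {f : Vtx p q (blockDeg α β) → ℝ}
    (hf : VtxRel α β f) : ∃ ψ : (Fin n → ℝ) →ₗ[ℝ] ℝ, ∀ x, ψ (latticeEmb (e x)) = f x := by
  obtain ⟨g, hg⟩ := he.lift f hf
  obtain ⟨ψ, hψ⟩ := exists_linear_extension g
  exact ⟨ψ, fun x => by rw [hψ, hg]⟩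

/-- The functional of a facet. -/
noncomputable def fn (he : IsRealization α β e)
    (F : CoreFacet p q × ∀ i, Fin (blockDeg α β i + 1)) : (Fin n → ℤ) →+ ℤ :=
  (he.lift _ (rel_facetVal α β F.1 F.2)).choose

lemma fn_apply (he : IsRealization α β e) (F : CoreFacet p q × ∀ i, Fin (blockDeg α β i + 1))
    (x : Vtx p q (blockDeg α β)) : he.fn F (e x) = facetVal α β F.1 F.2 x :=
  (he.lift _ (rel_facetVal α β F.1 F.2)).choose_spec x

theorem isFacetSystem [Fintype ι] (he : IsRealization α β e)
    (hn : n = 2 * p + q + 3 + ∑ i, blockDeg α β i) (hd : ∀ i, 0 < blockDeg α β i) :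
    IsFacetSystem e he.fn where
  fn_pt F x := by rw [he.fn_apply]; exact facetVal_eq_one_or_nonpos α β F.1 F.2 x
  closure_eq_top F := by
    rw [eq_top_iff, ← he.closure_eq_top, AddSubgroup.closure_le]
    rintro _ ⟨x, rfl⟩
    refine he.rel.mem_of_facet _ F.1 F.2 (fun y hy => AddSubgroup.subset_closure ?_) x
    rw [← he.fn_apply F] at hy
    exact ⟨y, hy, rfl⟩
  card_eq F := by
    simp only [he.fn_apply]
    rw [card_facetVal_eq_one, hn]
  exists_facet x := by
    suffices ∃ F σ, facetVal α β F σ x = 1 by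
      obtain ⟨F, σ, h⟩ := this
      exact ⟨(F, σ), by rw [he.fn_apply]; exact h⟩
    cases x with
    | t => exact ⟨.tv 0 0, fun _ => 0, rfl⟩
    | z => exact ⟨.zv 0 0, fun _ => 0, rfl⟩
    | y j => exact ⟨.nv 0, fun _ => 0, rfl⟩
    | u j => exact ⟨.nv 0, fun _ => 0, rfl⟩
    | v a => exact ⟨.ty 0 0, fun _ => 0, rfl⟩
    | x i k =>
      refine ⟨.nv 0, fun l => if (k : ℕ) = 0 then Fin.last _ else 0, ?_⟩
      have hk : k ≠ if (k : ℕ) = 0 then Fin.last _ else 0 := by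
        have := hd i
        split_ifs with h
        · rintro rfl
          rw [Fin.val_last] at h
          omega
        · rintro rfl
          exact h rfl
      simp only [facetVal, if_neg hk]
  complete ψ hψ := by
    obtain ⟨F, σ, h⟩ := (he.rel_linear ψ).exists_facet hψ
    exact ⟨(F, σ), fun x hx => by rw [he.fn_apply]; exact h x hx⟩
  eq_zero_of_nonpos ψ hψ := by
    refine linear_eq_zero_of_closure he.closure_eq_top ?_
    rintro _ ⟨x, rfl⟩
    exact (he.rel_linear ψ).eq_zero_of_nonpos hψ x

end IsRealization

/-! ### No vertex can be added -/

/-- The vertices that belong to a facet. -/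
def InFacet {p q : ℕ} {ι : Type} {d : ι → ℕ} :
    CoreFacet p q → (∀ i, Fin (d i + 1)) → Vtx p q d → Prop
  | .tv _ _, _, .t => True
  | .tv _ _, _, .z => False
  | .tv _ _, _, .y _ => True
  | .tv j _, _, .u l => l ≠ j
  | .tv _ a, _, .v c => c ≠ a
  | .ty _ _, _, .t => True
  | .ty _ _, _, .z => False
  | .ty _ k, _, .y l => l ≠ k
  | .ty j _, _, .u l => l ≠ j
  | .ty _ _, _, .v _ => True
  | .zv _ _, _, .t => False
  | .zv _ _, _, .z => True
  | .zv j _, _, .y l => l ≠ j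
  | .zv _ _, _, .u _ => True
  | .zv _ a, _, .v c => c ≠ a
  | .zu _ _, _, .t => False
  | .zu _ _, _, .z => True
  | .zu j _, _, .y l => l ≠ j
  | .zu _ k, _, .u l => l ≠ k
  | .zu _ _, _, .v _ => True
  | .nv _, _, .t => False
  | .nv _, _, .z => False
  | .nv _, _, .y _ => True
  | .nv _, _, .u _ => True
  | .nv a, _, .v c => c ≠ a
  | _, σ, .x i k => k ≠ σ i

lemma facetVal_eq_one_iff {p q : ℕ} {ι : Type} {α β : ι → Fin (p + 1) → ℕ}
    {F : CoreFacet p q} {σ : ∀ i, Fin (blockDeg α β i + 1)} {x : Vtx p q (blockDeg α β)} :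
    facetVal α β F σ x = 1 ↔ InFacet F σ x := by
  have key : ∀ (P : Prop) [Decidable P] (c : ℤ), 0 ≤ c → ((if P then -c else 1) = 1 ↔ ¬P) :=
    fun P _ c hc => by split_ifs <;> simp_all; omega
  cases F <;> cases x <;>
    simp (discharger := positivity) only [facetVal, InFacet, key, ne_eq] <;> simp

section Ridges

variable {p q : ℕ} {ι : Type} {d : ι → ℕ} {σ : ∀ i, Fin (d i + 1)} {y : Vtx p q d}

lemma InFacet.tv_nv {j : Fin (p + 1)} {a : Fin (q + 2)} (hy : y ≠ .t)
    (h : InFacet (.tv j a) σ y) : InFacet (.nv a) σ y := by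
  cases y <;> simp_all [InFacet]

lemma InFacet.nv_tv {j : Fin (p + 1)} {a : Fin (q + 2)} (hy : y ≠ .u j)
    (h : InFacet (.nv a) σ y) : InFacet (.tv j a) σ y := by
  cases y <;> simp_all [InFacet]

lemma InFacet.zv_nv {j : Fin (p + 1)} {a : Fin (q + 2)} (hy : y ≠ .z)
    (h : InFacet (.zv j a) σ y) : InFacet (.nv a) σ y := by
  cases y <;> simp_all [InFacet]

lemma InFacet.nv_zv {j : Fin (p + 1)} {a : Fin (q + 2)} (hy : y ≠ .y j)
    (h : InFacet (.nv a) σ y) : InFacet (.zv j a) σ y := by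
  cases y <;> simp_all [InFacet]

lemma InFacet.ty_tv {j k : Fin (p + 1)} {a : Fin (q + 2)} (hy : y ≠ .v a)
    (h : InFacet (.ty j k) σ y) : InFacet (.tv j a) σ y := by
  cases y <;> simp_all [InFacet]

lemma InFacet.tv_ty {j k : Fin (p + 1)} {a : Fin (q + 2)} (hy : y ≠ .y k)
    (h : InFacet (.tv j a) σ y) : InFacet (.ty j k) σ y := by
  cases y <;> simp_all [InFacet]

lemma InFacet.ty_zu {j k : Fin (p + 1)} (hy : y ≠ .t) (h : InFacet (.ty k j) σ y) :
    InFacet (.zu j k) σ y := by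
  cases y <;> simp_all [InFacet]

lemma InFacet.zu_ty {j k : Fin (p + 1)} (hy : y ≠ .z) (h : InFacet (.zu j k) σ y) :
    InFacet (.ty k j) σ y := by
  cases y <;> simp_all [InFacet]

lemma InFacet.zu_zv {j k : Fin (p + 1)} {a : Fin (q + 2)} (hy : y ≠ .v a)
    (h : InFacet (.zu j k) σ y) : InFacet (.zv j a) σ y := by
  cases y <;> simp_all [InFacet]

lemma InFacet.ty_ty_left {j k l : Fin (p + 1)} (hy : y ≠ .u l) (h : InFacet (.ty j k) σ y) :
    InFacet (.ty l k) σ y := by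
  cases y <;> simp_all [InFacet]

lemma InFacet.ty_ty_right {j k l : Fin (p + 1)} (hy : y ≠ .y l) (h : InFacet (.ty j k) σ y) :
    InFacet (.ty j l) σ y := by
  cases y <;> simp_all [InFacet]

lemma InFacet.update [DecidableEq ι] {F : CoreFacet p q} {i : ι} {k : Fin (d i + 1)}
    (hy : y ≠ .x i k) (h : InFacet F σ y) : InFacet F (Function.update σ i k) y := by
  cases y with
  | x i' k' =>
    have h' : k' ≠ σ i' := by cases F <;> exact h
    have : k' ≠ Function.update σ i k i' := by
      rcases eq_or_ne i' i with rfl | hi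
      · simpa using hy
      · rwa [Function.update_of_ne hi]
    cases F <;> exact this
  | _ => cases F <;> exact h

end Ridges

/-- A property of the choices of one vertex in each block that is stable under changing one choice
holds for all choices if it holds for one. -/
lemma of_update {ι : Type} [Finite ι] [DecidableEq ι] {κ : ι → Type} {g : (∀ i, κ i) → Prop}
    (h : ∀ σ i k, g σ → g (Function.update σ i k)) (σ τ : ∀ i, κ i) (hσ : g σ) : g τ := by
  have := Fintype.ofFinite ι
  have key : ∀ s : Finset ι, g (s.piecewise τ σ) := fun s => by
    induction s using Finset.induction_on with
    | empty => simpa using hσ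
    | insert i s _ ih =>
      rw [Finset.piecewise_insert]
      exact h _ _ _ ih
  simpa using key Finset.univ

namespace IsRealization

variable {p q : ℕ} {ι : Type} {α β : ι → Fin (p + 1) → ℕ} {n : ℕ}
  {e : Vtx p q (blockDeg α β) → Fin n → ℤ} {Q : Set (Fin n → ℝ)} {w : Fin n → ℤ}

/-- Crossing a ridge of degree one, in terms of the values at the vertices. -/
lemma two_le_of_ridge [Fintype ι] (he : IsRealization α β e)
    (hn : n = 2 * p + q + 3 + ∑ i, blockDeg α β i) (hd : ∀ i, 0 < blockDeg α β i)
    (hQ : IsSmoothFano Q) (hV : vertexSet Q = latticeEmb '' (insert w (range e))) (hw : w ∉ range e)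
    {F F' : CoreFacet p q} {σ σ' : ∀ i, Fin (blockDeg α β i + 1)} (hF : 2 ≤ he.fn (F, σ) w)
    (x : Vtx p q (blockDeg α β)) (hx : facetVal α β F' σ' x = 0)
    (hsub : ∀ y ≠ x, InFacet F σ y → InFacet F' σ' y) : 2 ≤ he.fn (F', σ') w := by
  refine (he.isFacetSystem hn hd).two_le_of_adjacent (by omega) hQ hV hw hF x ?_ ?_
  · rw [he.fn_apply, hx]
  · intro y hy
    rw [he.fn_apply, he.fn_apply, facetVal_eq_one_iff, facetVal_eq_one_iff]
    exact hsub y hy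

/-- All facets other than those of type `zu` are connected to each other across ridges of degree one:
a new vertex lies beyond all of them or beyond none. -/
lemma two_le_iff_of_not_zu [Fintype ι] (he : IsRealization α β e)
    (hn : n = 2 * p + q + 3 + ∑ i, blockDeg α β i) (hd : ∀ i, 0 < blockDeg α β i)
    (hQ : IsSmoothFano Q) (hV : vertexSet Q = latticeEmb '' (insert w (range e)))
    (hw : w ∉ range e) : ∃ B : Prop, ∀ (F : CoreFacet p q) (σ : ∀ i, Fin (blockDeg α β i + 1)),
      (2 ≤ he.fn (F, σ) w ↔ B) ∨ ∃ j k, F = .zu j k := by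
  classical
  have cross : ∀ {F F' : CoreFacet p q} {σ σ' : ∀ i, Fin (blockDeg α β i + 1)},
      2 ≤ he.fn (F, σ) w → ∀ x, facetVal α β F' σ' x = 0 →
      (∀ y ≠ x, InFacet F σ y → InFacet F' σ' y) → 2 ≤ he.fn (F', σ') w :=
    fun h x hx hsub => he.two_le_of_ridge hn hd hQ hV hw h x hx hsub
  have tv_nv : ∀ j a σ, 2 ≤ he.fn (.tv j a, σ) w ↔ 2 ≤ he.fn (.nv a, σ) w := fun j a σ =>
    ⟨fun h => cross h .t rfl fun y hy => .tv_nv hy,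
      fun h => cross h (.u j) (by simp [facetVal]) fun y hy => .nv_tv hy⟩
  have zv_nv : ∀ j a σ, 2 ≤ he.fn (.zv j a, σ) w ↔ 2 ≤ he.fn (.nv a, σ) w := fun j a σ =>
    ⟨fun h => cross h .z rfl fun y hy => .zv_nv hy,
      fun h => cross h (.y j) (by simp [facetVal]) fun y hy => .nv_zv hy⟩
  have ty_tv : ∀ j k a σ, 2 ≤ he.fn (.ty j k, σ) w ↔ 2 ≤ he.fn (.tv j a, σ) w := fun j k a σ =>
    ⟨fun h => cross h (.v a) (by simp [facetVal]) fun y hy => .ty_tv hy,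
      fun h => cross h (.y k) (by simp [facetVal]) fun y hy => .tv_ty hy⟩
  have nv_update : ∀ a σ i k, 2 ≤ he.fn (.nv a, σ) w →
      2 ≤ he.fn (.nv a, Function.update σ i k) w := fun a σ i k h =>
    cross h (.x i k) (by simp [facetVal]) fun y hy => .update hy
  have nv_nv : ∀ a a' σ σ', 2 ≤ he.fn (.nv a, σ) w → 2 ≤ he.fn (.nv a', σ') w :=
    fun a a' σ σ' h => by
      rw [← tv_nv 0 a', ← ty_tv 0 0 a', ty_tv 0 0 a, tv_nv]
      exact of_update (g := fun σ => 2 ≤ he.fn (.nv a, σ) w) (nv_update a) σ σ' h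
  refine ⟨2 ≤ he.fn (.nv 0, fun _ => 0) w, fun F σ => ?_⟩
  have hnv : ∀ a, 2 ≤ he.fn (.nv a, σ) w ↔ 2 ≤ he.fn (.nv 0, fun _ => 0) w := fun a =>
    ⟨nv_nv _ _ _ _, nv_nv _ _ _ _⟩
  cases F with
  | tv j a => exact .inl ((tv_nv j a σ).trans (hnv a))
  | ty j k => exact .inl ((ty_tv j k 0 σ).trans ((tv_nv j 0 σ).trans (hnv 0)))
  | zv j a => exact .inl ((zv_nv j a σ).trans (hnv a))
  | zu j k => exact .inr ⟨j, k, rfl⟩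
  | nv a => exact .inl (hnv a)

/-- No smooth Fano polytope arises by adding one vertex. The new vertex `w` would lie beyond some facet and
not beyond some other one, so the visibility would change between a facet `zu j k` and the facet `ty k j`,
which differ by the exchange of `z` and `t`. This determines the values of both functionals at `w`;
comparison with the other facets determines the signs of the coordinates of `w`, in contradiction to these
values. -/
theorem not_add_vertex [Fintype ι] (he : IsRealization α β e)
    (hn : n = 2 * p + q + 3 + ∑ i, blockDeg α β i) (hd : ∀ i, 0 < blockDeg α β i)
    (hQ : IsSmoothFano Q) (hV : vertexSet Q = latticeEmb '' (insert w (range e)))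
    (hw : w ∉ range e) : False := by
  classical
  have hn0 : 0 < n := by omega
  have hS := he.isFacetSystem hn hd
  have hdich : ∀ F, 2 ≤ he.fn F w ∨ he.fn F w ≤ 0 := fun F => by
    have := hS.fn_ne_one hn0 hQ hV hw F
    omega
  obtain ⟨B, hB⟩ := he.two_le_iff_of_not_zu hn hd hQ hV hw
  have hty : ∀ j k σ, 2 ≤ he.fn (.ty j k, σ) w ↔ B := fun j k σ =>
    (hB (.ty j k) σ).resolve_right (by rintro ⟨j, k, h⟩; cases h)
  have htv : ∀ j a σ, 2 ≤ he.fn (.tv j a, σ) w ↔ B := fun j k σ =>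
    (hB (.tv j k) σ).resolve_right (by rintro ⟨j, k, h⟩; cases h)
  have hzv : ∀ j a σ, 2 ≤ he.fn (.zv j a, σ) w ↔ B := fun j k σ =>
    (hB (.zv j k) σ).resolve_right (by rintro ⟨j, k, h⟩; cases h)
  -- The comparison of two functionals in terms of the coordinates with respect to a facet.
  have hcmp : ∀ (G : CoreFacet p q × ∀ i, Fin (blockDeg α β i + 1)) (c : Vtx p q (blockDeg α β) → ℤ),
      w = ∑ x, c x • e x → (∀ x, he.fn G (e x) ≠ 1 → c x = 0) →
      ∀ (F F' : CoreFacet p q × ∀ i, Fin (blockDeg α β i + 1)) (x : Vtx p q (blockDeg α β)),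
      (∀ y ≠ x, InFacet G.1 G.2 y → facetVal α β F.1 F.2 y = facetVal α β F'.1 F'.2 y) →
      he.fn F w - he.fn F' w =
        c x * (facetVal α β F.1 F.2 x - facetVal α β F'.1 F'.2 x) := by
    intro G c hc hc0 F F' x hsub
    rw [IsFacetSystem.sub_eq_coeff_mul hc hc0 (he.fn F) (he.fn F') x, he.fn_apply, he.fn_apply]
    intro y hy h1
    rw [he.fn_apply, facetVal_eq_one_iff] at h1
    rw [he.fn_apply, he.fn_apply, hsub y hy h1]
  have hsum : ∀ (G : CoreFacet p q × ∀ i, Fin (blockDeg α β i + 1)) (c : Vtx p q (blockDeg α β) → ℤ),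
      w = ∑ x, c x • e x → (∀ x, he.fn G (e x) ≠ 1 → c x = 0) → he.fn G w = ∑ x, c x := by
    intro G c hc hc0
    conv_lhs => rw [hc, IsFacetSystem.map_sum_smul]
    refine Finset.sum_congr rfl fun x _ => ?_
    by_cases hx : he.fn G (e x) = 1
    · rw [hx, mul_one]
    · rw [hc0 x hx, zero_mul]
  by_cases hb : B
  · -- Some facet is invisible; it is of type `zu`.
    obtain ⟨⟨F, σ⟩, hF⟩ := hS.exists_fn_nonpos hn0 w
    obtain ⟨j, k, rfl⟩ := (hB F σ).resolve_left (by intro h; have := h.2 hb; omega)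
    obtain ⟨c, hc, hc0⟩ := hS.exists_coeff (.ty k j, σ) w
    have hvis : 2 ≤ he.fn (.ty k j, σ) w := (hty k j σ).2 hb
    have hct : c .t = 1 := hS.coeff_eq_one hn0 hQ hV hw hvis hF (by rw [he.fn_apply]; rfl)
      (fun y hy => by
        rw [he.fn_apply, he.fn_apply, facetVal_eq_one_iff, facetVal_eq_one_iff]
        exact .ty_zu hy) hc hc0
    have hcmp' : ∀ F σ' x, (∀ y ≠ x, InFacet (.ty k j) σ y → InFacet F σ' y) → InFacet (.ty k j) σ x →
        he.fn (.ty k j, σ) w - he.fn (F, σ') w = c x * (1 - facetVal α β F σ' x) :=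
      fun F σ' x hsub hx => by
        rw [hcmp _ c hc hc0 (.ty k j, σ) (F, σ') x fun y hy hy' => ?_, facetVal_eq_one_iff.2 hx]
        rw [facetVal_eq_one_iff.2 hy', facetVal_eq_one_iff.2 (hsub y hy hy')]
    have hval := hcmp' (.zu j k) σ .t (fun y hy => .ty_zu hy) trivial
    rw [hct] at hval
    have hout : ∀ x, ¬InFacet (.ty k j) σ x → c x = 0 := fun x hx => hc0 x (by
      rwa [he.fn_apply, ne_eq, facetVal_eq_one_iff])
    have hsumc := hsum _ c hc hc0
    rw [sum_vtx] at hsumc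
    have hcz : c .z = 0 := hout _ (by simp [InFacet])
    have hval' : he.fn (.ty k j, σ) w = 2 := by
      simp only [facetVal] at hval
      omega
    have hcv : ∑ a, c (.v a) ≤ 0 := Finset.sum_nonpos fun a _ => by
      have h1 := hcmp' (.tv k a) σ (.v a) (fun y hy => .ty_tv hy) trivial
      have h2 := (htv k a σ).2 hb
      simp [facetVal] at h1
      omega
    have hcy : ∑ l, c (.y l) ≤ 0 := Finset.sum_nonpos fun l _ => by
      by_cases hl : InFacet (q := q) (d := blockDeg α β) (.ty k j) σ (.y l)
      · have h1 := hcmp' (.ty k l) σ (.y l) (fun y hy => .ty_ty_right hy) hl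
        have h2 := (hty k l σ).2 hb
        simp [facetVal] at h1
        omega
      · exact (hout _ hl).le
    have hcu : ∑ l, c (.u l) ≤ 0 := Finset.sum_nonpos fun l _ => by
      by_cases hl : InFacet (q := q) (d := blockDeg α β) (.ty k j) σ (.u l)
      · have h1 := hcmp' (.ty l j) σ (.u l) (fun y hy => .ty_ty_left hy) hl
        have h2 := (hty l j σ).2 hb
        simp [facetVal] at h1
        omega
      · exact (hout _ hl).le
    have hcx : ∑ i, ∑ m, c (.x i m) ≤ 0 := Finset.sum_nonpos fun i _ => Finset.sum_nonpos fun m _ => by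
      by_cases hl : InFacet (q := q) (d := blockDeg α β) (.ty k j) σ (.x i m)
      · have h1 := hcmp' (.ty k j) (Function.update σ i m) (.x i m) (fun y hy => .update hy) hl
        have h2 := (hty k j (Function.update σ i m)).2 hb
        simp only [facetVal, Function.update_self, if_true] at h1
        have h3 : (0 : ℤ) < 1 - -(α i j + 2 * β i k) := by rw [sub_neg_eq_add]; positivity
        by_contra! hneg
        have := mul_pos hneg h3
        omega
      · exact (hout _ hl).le
    omega
  · -- Some facet is visible; it is of type `zu`.
    obtain ⟨⟨F, σ⟩, hF⟩ := hS.exists_two_le hn0 hV hQ hw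
    obtain ⟨j, k, rfl⟩ := (hB F σ).resolve_left (by intro h; exact hb (h.1 hF))
    obtain ⟨c, hc, hc0⟩ := hS.exists_coeff (.zu j k, σ) w
    have hty' : ∀ j k σ, he.fn (.ty j k, σ) w ≤ 0 := fun j k σ =>
      (hdich _).resolve_left fun h => hb ((hty j k σ).1 h)
    have hcz : c .z = 1 := hS.coeff_eq_one hn0 hQ hV hw hF (hty' k j σ) (by rw [he.fn_apply]; rfl)
      (fun y hy => by
        rw [he.fn_apply, he.fn_apply, facetVal_eq_one_iff, facetVal_eq_one_iff]
        exact .zu_ty hy) hc hc0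
    have hval := hcmp _ c hc hc0 (.zu j k, σ) (.ty k j, σ) .z fun y hy hy' => by
      rw [facetVal_eq_one_iff.2 hy', facetVal_eq_one_iff.2 (hy'.zu_ty hy)]
    rw [hcz] at hval
    simp only [facetVal] at hval
    have hval0 := hty' k j σ
    have hval' : he.fn (.ty k j, σ) w = 0 := by omega
    -- The functionals of type `ty` have the value `-1` at `z` and otherwise share a ridge.
    have hcmp' : ∀ j' k' σ' x, (∀ y ≠ x, InFacet (.ty k j) σ y → InFacet (.ty j' k') σ' y) →
        InFacet (.zu j k) σ x → x ≠ .z →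
        0 ≤ c x * (1 - facetVal α β (.ty j' k') σ' x) := fun j' k' σ' x hsub hx hxz => by
      have h1 := hcmp _ c hc hc0 (.ty k j, σ) (.ty j' k', σ') x fun y hy hy' => by
        by_cases hyz : y = .z
        · rw [hyz]; rfl
        · rw [facetVal_eq_one_iff.2 (hy'.zu_ty hyz),
            facetVal_eq_one_iff.2 (hsub y hy (hy'.zu_ty hyz))]
      rw [facetVal_eq_one_iff.2 (hx.zu_ty hxz)] at h1
      have h2 := hty' j' k' σ'
      dsimp only at h1
      omega
    have hout : ∀ x, ¬InFacet (.zu j k) σ x → c x = 0 := fun x hx => hc0 x (by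
      rwa [he.fn_apply, ne_eq, facetVal_eq_one_iff])
    have hsumc := hsum _ c hc hc0
    rw [sum_vtx] at hsumc
    have hct : c .t = 0 := hout _ (by simp [InFacet])
    have hcv : (q + 2 : ℤ) ≤ ∑ a, c (.v a) := by
      have : ∀ a ∈ Finset.univ, 1 ≤ c (.v a) := fun a _ => by
        have h1 := hcmp _ c hc hc0 (.zu j k, σ) (.zv j a, σ) (.v a) fun y hy hy' => by
          rw [facetVal_eq_one_iff.2 hy', facetVal_eq_one_iff.2 (hy'.zu_zv hy)]
        have h2 : he.fn (.zv j a, σ) w ≤ 0 := (hdich _).resolve_left fun h => hb ((hzv j a σ).1 h)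
        simp only [facetVal, if_true] at h1
        by_contra! hneg
        have h3 : (0 : ℤ) < 1 - -(2 * p + 2 * q + 3) := by rw [sub_neg_eq_add]; positivity
        have := mul_nonpos_of_nonpos_of_nonneg (Int.lt_add_one_iff.1 hneg) h3.le
        omega
      simpa using Finset.card_nsmul_le_sum _ _ _ this
    have hcy : 0 ≤ ∑ l, c (.y l) := Finset.sum_nonneg fun l _ => by
      by_cases hl : InFacet (q := q) (d := blockDeg α β) (.zu j k) σ (.y l)
      · simpa [facetVal] using
          hcmp' k l σ (.y l) (fun y hy => .ty_ty_right hy) hl (by simp)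
      · exact (hout _ hl).ge
    have hcu : 0 ≤ ∑ l, c (.u l) := Finset.sum_nonneg fun l _ => by
      by_cases hl : InFacet (q := q) (d := blockDeg α β) (.zu j k) σ (.u l)
      · simpa [facetVal] using
          hcmp' l j σ (.u l) (fun y hy => .ty_ty_left hy) hl (by simp)
      · exact (hout _ hl).ge
    have hcx : 0 ≤ ∑ i, ∑ m, c (.x i m) := Finset.sum_nonneg fun i _ => Finset.sum_nonneg fun m _ => by
      by_cases hl : InFacet (q := q) (d := blockDeg α β) (.zu j k) σ (.x i m)
      · have h1 := hcmp' k j (Function.update σ i m) (.x i m) (fun y hy => .update hy) hl (by simp)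
        simp only [facetVal, Function.update_self, if_true] at h1
        have h3 : (0 : ℤ) < 1 - -(α i j + 2 * β i k) := by rw [sub_neg_eq_add]; positivity
        exact nonneg_of_mul_nonneg_left h1 h3
      · exact (hout _ hl).ge
    omega

end IsRealization

/-! ### No vertex can be removed -/

lemma sum_ite_zero {m : ℕ} (c r : ℝ) :
    ∑ k : Fin (m + 1), (if k = 0 then c else r) = c + m * r := by
  simp [Fin.sum_univ_succ, Fin.succ_ne_zero]

open Classical in
/-- The difference of two coordinates from the same block: the function on the vertices that is `1` at
`x₁`, is `-1` at `x₀`, and is `0` elsewhere. -/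
noncomputable def coordSub {p q : ℕ} {ι : Type} {d : ι → ℕ} (x₀ x₁ x : Vtx p q d) : ℝ :=
  (if x = x₁ then 1 else 0) - if x = x₀ then 1 else 0

lemma rel_coordSub_v {p q : ℕ} {ι : Type} (α β : ι → Fin (p + 1) → ℕ) (a b : Fin (q + 2)) :
    VtxRel α β (coordSub (.v a) (.v b)) where
  tz := by simp [coordSub]
  yu := by simp [coordSub]
  vy := by simp [coordSub]
  x i := by simp [coordSub]

lemma rel_coordSub_x {p q : ℕ} {ι : Type} (α β : ι → Fin (p + 1) → ℕ) (i : ι)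
    (a b : Fin (blockDeg α β i + 1)) : VtxRel (q := q) α β (coordSub (.x i a) (.x i b)) where
  tz := by simp [coordSub]
  yu := by simp [coordSub]
  vy := by simp [coordSub]
  x l := by
    by_cases hl : l = i
    · subst hl; simp [coordSub]
    · simp [coordSub, hl]

lemma rel_coordSub_y {p q : ℕ} {ι : Type} [IsEmpty ι] (α β : ι → Fin (p + 1) → ℕ)
    (a b : Fin (p + 1)) : VtxRel (q := q) α β (coordSub (.y a) (.y b)) where
  tz := by simp [coordSub]
  yu := by simp [coordSub]
  vy := by simp [coordSub]
  x l := isEmptyElim l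

lemma rel_coordSub_u {p q : ℕ} {ι : Type} [IsEmpty ι] (α β : ι → Fin (p + 1) → ℕ)
    (a b : Fin (p + 1)) : VtxRel (q := q) α β (coordSub (.u a) (.u b)) where
  tz := by simp [coordSub]
  yu := by simp [coordSub]
  vy := by simp [coordSub]
  x l := isEmptyElim l

namespace IsRealization

section Remove

variable {p q : ℕ} {ι : Type} {α β : ι → Fin (p + 1) → ℕ} {n : ℕ}
  {e : Vtx p q (blockDeg α β) → Fin n → ℤ} {Q : Set (Fin n → ℝ)} {x₀ : Vtx p q (blockDeg α β)}

/-- Without the vertex `x₀` the origin is not an interior point if some functional is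
nonnegative at all other vertices. -/
lemma false_of_nonneg (he : IsRealization α β e) (hQ : IsSmoothFano Q)
    (hV : vertexSet Q = latticeEmb '' (range e \ {e x₀})) {f : Vtx p q (blockDeg α β) → ℝ}
    (hf : VtxRel α β f) (hnn : ∀ x ≠ x₀, 0 ≤ f x) {x₁ : Vtx p q (blockDeg α β)} (hx₁ : f x₁ ≠ 0) :
    False := by
  obtain ⟨ψ, hψ⟩ := he.exists_linear hf
  have hψ0 : -ψ ≠ 0 := fun h => hx₁ (by
    rw [← hψ, neg_eq_zero.1 h, LinearMap.zero_apply])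
  have hle : ∀ y ∈ Q, (-ψ) y ≤ 0 := fun y hy => by
    rw [← hQ.1.convexHull_vertexSet, hV] at hy
    refine linear_le_of_mem_convexHull ?_ hy
    rintro _ ⟨_, ⟨⟨x, rfl⟩, hx⟩, rfl⟩
    rw [LinearMap.neg_apply, hψ, neg_nonpos]
    exact hnn x fun h => hx (by rw [h]; rfl)
  simpa using linear_lt_of_mem_interior hle hψ0 hQ.2.1

lemma false_of_coordSub (he : IsRealization α β e) (hQ : IsSmoothFano Q)
    (hV : vertexSet Q = latticeEmb '' (range e \ {e x₀})) {x₁ : Vtx p q (blockDeg α β)}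
    (hx₁ : x₁ ≠ x₀) (hf : VtxRel α β (coordSub x₀ x₁)) : False := by
  refine he.false_of_nonneg hQ hV hf (fun x hx => ?_) (x₁ := x₁) ?_
  · simp only [coordSub, if_neg hx]
    split_ifs <;> norm_num
  · simp [coordSub, hx₁]

/-- `IsSmoothFano.exists_dual`, for the polytope without the vertex `x₀` and in terms of the values of
functionals at the vertices. -/
lemma false_of_dual (he : IsRealization α β e) (hinj : Function.Injective e) (hn : 0 < n)
    (hQ : IsSmoothFano Q) (hV : vertexSet Q = latticeEmb '' (range e \ {e x₀}))
    {f : Vtx p q (blockDeg α β) → ℝ} {x₁ : Vtx p q (blockDeg α β)}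
    (h : ∀ l : Vtx p q (blockDeg α β) → ℤ, VtxRel α β l → l x₁ = 1 →
      (∀ x ≠ x₀, f x = 1 → x ≠ x₁ → l x = 0) → False)
    (hf : VtxRel α β f) (hle : ∀ x ≠ x₀, f x ≤ 1)
    (hspan : ∀ g : Vtx p q (blockDeg α β) → ℝ, VtxRel α β g → (∀ x ≠ x₀, f x = 1 → g x = 0) →
      ∀ x, g x = 0) (hx₁ : x₁ ≠ x₀) (hfx₁ : f x₁ = 1) : False := by
  obtain ⟨ψ, hψ⟩ := he.exists_linear hf
  have hmem : ∀ x ≠ x₀, e x ∈ range e \ {e x₀} := fun x hx => ⟨⟨x, rfl⟩, fun h => hx (hinj h)⟩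
  have hle' : ∀ w ∈ range e \ {e x₀}, ψ (latticeEmb w) ≤ 1 := by
    rintro _ ⟨⟨x, rfl⟩, hx⟩
    rw [hψ]
    exact hle x fun h => hx (by rw [h]; rfl)
  obtain ⟨l, hl1, hl0⟩ := hQ.exists_dual hn hV hle' (fun μ hμ => by
    refine linear_eq_zero_of_closure he.closure_eq_top ?_
    rintro _ ⟨x, rfl⟩
    exact hspan _ (he.rel_linear μ) (fun x hx hfx => hμ _ (hmem x hx) (by rw [hψ, hfx])) x)
    (hmem x₁ hx₁) (by rw [hψ, hfx₁])
  exact h (fun x => l (e x)) (he.rel.map l) hl1 fun x hx hfx hne =>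
    hl0 _ (hmem x hx) (by rw [hψ, hfx]) fun h => hne (hinj h)

lemma not_remove_z (he : IsRealization α β e) (hQ : IsSmoothFano Q)
    (hV : vertexSet Q = latticeEmb '' (range e \ {e .z})) : False := by
  refine he.false_of_nonneg hQ hV (x₁ := .t) (f := fun x => match x with
    | .t => 1
    | .z => -1
    | .y j => if j = 0 then 1 else 0
    | .u _ => 0
    | .v a => if a = 0 then p + q + 1 else 0
    | .x i k => if k = 0 then α i 0 else 0)
    ⟨by norm_num, by simp, ?_, fun i => by simp⟩ (fun x hx => ?_) one_ne_zero
  · simp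
    ring
  · cases x with
    | z => exact absurd rfl hx
    | _ => dsimp only; positivity

/-- If `t` is removed, then the vertices other than `t`, `z`, `u 0` and `x i 0` are those of a
facet; the lattice that they generate contains `(p + q + 2) t` but not `t`. -/
lemma not_remove_t (he : IsRealization α β e) (hinj : Function.Injective e) (hn : 0 < n)
    (hQ : IsSmoothFano Q) (hV : vertexSet Q = latticeEmb '' (range e \ {e .t})) : False := by
  have hm : (0 : ℝ) < p + q + 2 := by positivity
  have hr : (p + q + 2 : ℝ) * ((p + q + 2 : ℝ)⁻¹ + 1) = p + q + 3 := by
    field_simp; ring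
  set r : ℝ := (p + q + 2 : ℝ)⁻¹ with hr'
  have hr0 : 0 < r := by positivity
  refine he.false_of_dual hinj hn hQ hV (fun l hl hl1 hl0 => ?_) (x₁ := .v 0) (f := fun x => match x with
    | .t => r + 1
    | .z => -(r + 1)
    | .y _ => 1
    | .u j => if j = 0 then -r else 1
    | .v _ => 1
    | .x i k => if k = 0 then -(β i 0 * (r + 1)) else 1)
    ⟨by simp, ?_, ?_, fun i => ?_⟩ (fun x hx => ?_) ?_ (by simp) rfl
  · have hv : ∑ a, l (.v a) = 1 := by
      rw [Fintype.sum_eq_single 0 fun a ha => hl0 _ (by simp) rfl (by simpa using ha), hl1]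
    have hy : ∑ j, l (.y j) = 0 := Finset.sum_eq_zero fun j _ => hl0 _ (by simp) rfl (by simp)
    have h := hl.vy
    rw [hv, hy, nsmul_eq_mul, add_zero] at h
    have h1 : ((p + q + 2 : ℕ) : ℤ) ∣ 1 := ⟨_, h⟩
    have h2 := Int.le_of_dvd one_pos h1
    push_cast at h2
    omega
  · simp only [sum_ite_zero]
    simp
    ring
  · simp
    linarith
  · have : ∑ j, (β i j : ℝ) * (if j = 0 then -r else 1) = ∑ j, (β i j : ℝ) - β i 0 * (r + 1) := by
      simp only [Fin.sum_univ_succ, Fin.succ_ne_zero, if_true, if_false]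
      ring_nf
    simp only [nsmul_eq_mul, this, sum_ite_zero]
    simp only [blockDeg]
    push_cast
    simp
    ring
  · have : ∀ i, 0 ≤ (β i 0 : ℝ) * (r + 1) := fun i => by positivity
    cases x with
    | t => exact absurd rfl hx
    | x i k => dsimp only; split_ifs <;> linarith [this i]
    | _ => dsimp only; first | (split_ifs <;> linarith) | linarith
  · intro g hg h0
    have hy : ∀ j, g (.y j) = 0 := fun j => h0 _ (by simp) rfl
    have hv : ∀ a, g (.v a) = 0 := fun j => h0 _ (by simp) rfl
    have ht : g .t = 0 := by
      have := hg.vy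
      simp only [hy, hv, Finset.sum_const_zero, add_zero, nsmul_eq_mul] at this
      push_cast at this
      exact (mul_eq_zero.1 this.symm).resolve_left hm.ne'
    have hz : g .z = 0 := by simpa [ht] using hg.tz
    have hu : ∀ j, g (.u j) = 0 := fun j => by
      have h1 : ∑ j, g (.u j) = 0 := by simp [← hg.yu, hy, hz]
      have h2 : ∀ k : Fin (p + 1), k ≠ 0 → g (.u k) = 0 := fun k hk => h0 _ (by simp) (by simp [hk])
      rw [Fintype.sum_eq_single 0 h2] at h1
      by_cases hj : j = 0
      · rw [hj, h1]
      · exact h2 j hj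
    intro x
    cases x with
    | t => exact ht
    | z => exact hz
    | y j => exact hy j
    | u j => exact hu j
    | v j => exact hv j
    | x i k =>
      have h1 : ∑ k, g (.x i k) = 0 := by simp [hg.x, hy, hu]
      have h2 : ∀ k : Fin (blockDeg α β i + 1), k ≠ 0 → g (.x i k) = 0 :=
        fun k hk => h0 _ (by simp) (by simp [hk])
      rw [Fintype.sum_eq_single 0 h2] at h1
      by_cases hk : k = 0
      · rw [hk, h1]
      · exact h2 k hk

end Remove

section RemoveSingle

variable {q : ℕ} {ι : Type} {α β : ι → Fin (0 + 1) → ℕ} {n : ℕ}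
  {e : Vtx 0 q (blockDeg α β) → Fin n → ℤ} {Q : Set (Fin n → ℝ)}

/-- If `y` is removed, then `t` belongs to a facet together with `u`, with all `v` but one and with at
least all but one of each block `x i`, and with all of the block if `α i = 1`. The sum of such a block is
`t + (1 + β i) u`. -/
lemma not_remove_y (he : IsRealization α β e) (hinj : Function.Injective e) (hn : 0 < n)
    (hQ : IsSmoothFano Q) (hV : vertexSet Q = latticeEmb '' (range e \ {e (.y 0)}))
    (hα : ∀ i, α i 0 ≤ 1) {i₀ : ι} (hi₀ : α i₀ 0 = 1) : False := by
  refine he.false_of_dual hinj hn hQ hV (fun l hl hl1 hl0 => ?_) (x₁ := .t) (f := fun x => match x with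
    | .t => 1
    | .z => -1
    | .y _ => 2
    | .u j => 1
    | .v a => if a = 0 then -1 else 1
    | .x i k => if k = 0 then α i 0 else 1)
    ⟨by simp, ?_, ?_, fun i => ?_⟩ (fun x hx => ?_) ?_ (by simp) rfl
  · have hu : l (.u 0) = 0 := hl0 _ (by simp) rfl (by simp)
    have hx : ∑ k, l (.x i₀ k) = 0 := Finset.sum_eq_zero fun k _ => hl0 _ (by simp)
      (by simp [hi₀]) (by simp)
    have h1 := hl.x i₀
    have h2 := hl.yu
    have h3 := hl.tz
    simp [hu, hi₀, hx] at h1 h2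
    omega
  · simp
    norm_num
  · simp only [sum_ite_zero]
    simp
  · simp only [sum_ite_zero]
    simp [blockDeg]
    ring
  · cases x with
    | y j => rw [Fin.eq_zero j] at hx; exact absurd rfl hx
    | x i k =>
      dsimp only
      have : (α i 0 : ℝ) ≤ 1 := by exact_mod_cast hα i
      split_ifs <;> linarith
    | _ => dsimp only; first | (split_ifs <;> norm_num) | norm_num
  · intro g hg h0
    have ht : g .t = 0 := h0 _ (by simp) rfl
    have hu : ∀ j, g (.u j) = 0 := fun j => h0 _ (by simp) rfl
    have hz : g .z = 0 := by simpa [ht] using hg.tz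
    have hy : ∀ j, g (.y j) = 0 := fun j => by
      have h1 : ∑ j, g (.y j) = 0 := by simpa [hu, hz] using hg.yu
      rw [Fin.eq_zero j]
      simpa using h1
    have hv : ∀ a, g (.v a) = 0 := fun a => by
      have h1 : ∑ j, g (.v j) = 0 := by simpa [hy, ht] using hg.vy
      have h2 : ∀ k : Fin (q + 2), k ≠ 0 → g (.v k) = 0 := fun k hk => h0 _ (by simp) (by simp [hk])
      rw [Fintype.sum_eq_single 0 h2] at h1
      by_cases ha : a = 0
      · rw [ha, h1]
      · exact h2 a ha
    intro x
    cases x with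
    | t => exact ht
    | z => exact hz
    | y j => exact hy j
    | u j => exact hu j
    | v j => exact hv j
    | x i k =>
      have h1 : ∑ k, g (.x i k) = 0 := by simp [hg.x, hy, hu]
      have h2 : ∀ k : Fin (blockDeg α β i + 1), k ≠ 0 → g (.x i k) = 0 :=
        fun k hk => h0 _ (by simp) (by simp [hk])
      rw [Fintype.sum_eq_single 0 h2] at h1
      by_cases hk : k = 0
      · rw [hk, h1]
      · exact h2 k hk

/-- If `u` is removed, then `z` belongs to a facet together with `y`, with all `v` but one and with at
least all but one of each block `x i`, and with all of the block if `β i = 1`. The sum of such a block is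
`(α i + 1) y + z`. -/
lemma not_remove_u (he : IsRealization α β e) (hinj : Function.Injective e) (hn : 0 < n)
    (hQ : IsSmoothFano Q) (hV : vertexSet Q = latticeEmb '' (range e \ {e (.u 0)}))
    (hβ : ∀ i, β i 0 ≤ 1) {i₀ : ι} (hi₀ : β i₀ 0 = 1) : False := by
  refine he.false_of_dual hinj hn hQ hV (fun l hl hl1 hl0 => ?_) (x₁ := .z) (f := fun x => match x with
    | .t => -1
    | .z => 1
    | .y _ => 1
    | .u j => 2
    | .v a => if a = 0 then -(2 * q + 4) else 1
    | .x i k => if k = 0 then β i 0 else 1)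
    ⟨by simp, ?_, ?_, fun i => ?_⟩ (fun x hx => ?_) ?_ (by simp) rfl
  · have hy : l (.y 0) = 0 := hl0 _ (by simp) rfl (by simp)
    have hx : ∑ k, l (.x i₀ k) = 0 := Finset.sum_eq_zero fun k _ => hl0 _ (by simp)
      (by simp [hi₀]) (by simp)
    have h1 := hl.x i₀
    have h2 := hl.yu
    simp [hy, hi₀, hx] at h1 h2
    omega
  · simp
    norm_num
  · simp only [sum_ite_zero]
    simp
    ring
  · simp only [sum_ite_zero]
    simp [blockDeg]
    ring
  · have hq : (0 : ℝ) ≤ q := Nat.cast_nonneg q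
    cases x with
    | u j => rw [Fin.eq_zero j] at hx; exact absurd rfl hx
    | x i k =>
      dsimp only
      have : (β i 0 : ℝ) ≤ 1 := by exact_mod_cast hβ i
      split_ifs <;> linarith
    | _ => dsimp only; first | (split_ifs <;> linarith) | norm_num
  · intro g hg h0
    have hz : g .z = 0 := h0 _ (by simp) rfl
    have hy : ∀ j, g (.y j) = 0 := fun j => h0 _ (by simp) rfl
    have ht : g .t = 0 := by simpa [hz] using hg.tz
    have hu : ∀ j, g (.u j) = 0 := fun j => by
      have h1 : ∑ j, g (.u j) = 0 := by rw [← hg.yu]; simp [hy, hz]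
      rw [Fin.eq_zero j]
      simpa using h1
    have hv : ∀ a, g (.v a) = 0 := fun a => by
      have h1 : ∑ j, g (.v j) = 0 := by simpa [hy, ht] using hg.vy
      have h2 : ∀ k : Fin (q + 2), k ≠ 0 → g (.v k) = 0 := fun k hk => h0 _ (by simp) (by simp [hk])
      rw [Fintype.sum_eq_single 0 h2] at h1
      by_cases ha : a = 0
      · rw [ha, h1]
      · exact h2 a ha
    intro x
    cases x with
    | t => exact ht
    | z => exact hz
    | y j => exact hy j
    | u j => exact hu j
    | v j => exact hv j
    | x i k =>
      have h1 : ∑ k, g (.x i k) = 0 := by simp [hg.x, hy, hu]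
      have h2 : ∀ k : Fin (blockDeg α β i + 1), k ≠ 0 → g (.x i k) = 0 :=
        fun k hk => h0 _ (by simp) (by simp [hk])
      rw [Fintype.sum_eq_single 0 h2] at h1
      by_cases hk : k = 0
      · rw [hk, h1]
      · exact h2 k hk

end RemoveSingle

end IsRealization

/-- Parameters for which no vertex can be removed: there are no blocks `x i` and at least two `y`, or there
are a single `y` and a single `u`, each of which enters some block relation, with coefficients at
most one. -/
def IsRigid {p : ℕ} {ι : Type} (α β : ι → Fin (p + 1) → ℕ) : Prop :=
  (1 ≤ p ∧ IsEmpty ι) ∨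
    (p = 0 ∧ (∀ i, α i 0 ≤ 1 ∧ β i 0 ≤ 1) ∧ (∃ i, α i 0 = 1) ∧ ∃ i, β i 0 = 1)

theorem IsRealization.not_remove_vertex {p q : ℕ} {ι : Type} {α β : ι → Fin (p + 1) → ℕ} {n : ℕ}
    {e : Vtx p q (blockDeg α β) → Fin n → ℤ} {Q : Set (Fin n → ℝ)} (he : IsRealization α β e)
    (hinj : Function.Injective e) (hn : 0 < n) (hd : ∀ i, 0 < blockDeg α β i) (hr : IsRigid α β)
    (hQ : IsSmoothFano Q) (x₀ : Vtx p q (blockDeg α β))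
    (hV : vertexSet Q = latticeEmb '' (range e \ {e x₀})) : False := by
  have hother : ∀ {m : ℕ} (_ : 1 ≤ m) (a : Fin (m + 1)), ∃ b, b ≠ a := fun hm a =>
    haveI := Fin.nontrivial_iff_two_le.2 (Nat.succ_le_succ hm)
    exists_ne a
  cases x₀ with
  | t => exact he.not_remove_t hinj hn hQ hV
  | z => exact he.not_remove_z hQ hV
  | v a =>
    obtain ⟨b, hb⟩ := hother (by omega) a
    exact he.false_of_coordSub hQ hV (x₁ := .v b) (by simpa using hb) (rel_coordSub_v α β a b)
  | x i a =>
    obtain ⟨b, hb⟩ := hother (hd i) a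
    exact he.false_of_coordSub hQ hV (x₁ := .x i b) (by simpa using hb) (rel_coordSub_x α β i a b)
  | y j =>
    rcases hr with ⟨hp, hι⟩ | ⟨rfl, hle, ⟨i, hi⟩, -⟩
    · obtain ⟨b, hb⟩ := hother hp j
      exact he.false_of_coordSub hQ hV (x₁ := .y b) (by simpa using hb) (rel_coordSub_y α β j b)
    · obtain rfl : j = 0 := Fin.eq_zero j
      exact he.not_remove_y hinj hn hQ hV (fun i => (hle i).1) hi
  | u j =>
    rcases hr with ⟨hp, hι⟩ | ⟨rfl, hle, -, ⟨i, hi⟩⟩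
    · obtain ⟨b, hb⟩ := hother hp j
      exact he.false_of_coordSub hQ hV (x₁ := .u b) (by simpa using hb) (rel_coordSub_u α β j b)
    · obtain rfl : j = 0 := Fin.eq_zero j
      exact he.not_remove_u hinj hn hQ hV (fun i => (hle i).2) hi

/-! ### Existence of realizations -/

/-- Indices of a lattice basis consisting of vertices: `t`, all `y`, and all but the first vertex of each of the
blocks `u`, `v` and `x i`. -/
abbrev BasisIdx (p q : ℕ) {ι : Type} (d : ι → ℕ) : Type :=
  Unit ⊕ Fin (p + 1) ⊕ Fin p ⊕ Fin (q + 1) ⊕ Σ i, Fin (d i)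

namespace BasisIdx

variable {p q : ℕ} {ι : Type}

/-- The vertex with the given index. -/
def toVtx {d : ι → ℕ} : BasisIdx p q d → Vtx p q d
  | .inl _ => .t
  | .inr (.inl j) => .y j
  | .inr (.inr (.inl j)) => .u j.succ
  | .inr (.inr (.inr (.inl a))) => .v a.succ
  | .inr (.inr (.inr (.inr ⟨i, k⟩))) => .x i k.succ

/-- The extension of a function from the basis to all vertices by means of the relations. -/
def extend {α β : ι → Fin (p + 1) → ℕ} {M : Type} [AddCommGroup M]
    (g : BasisIdx p q (blockDeg α β) → M) : Vtx p q (blockDeg α β) → M :=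
  let t : M := g (.inl ())
  let y : Fin (p + 1) → M := fun j => g (.inr (.inl j))
  let u : Fin (p + 1) → M :=
    Fin.cons (∑ j, y j - t - ∑ j, g (.inr (.inr (.inl j)))) fun j => g (.inr (.inr (.inl j)))
  fun
  | .t => t
  | .z => -t
  | .y j => y j
  | .u j => u j
  | .v a => (Fin.cons ((p + q + 2) • t - ∑ j, y j - ∑ a, g (.inr (.inr (.inr (.inl a)))))
      fun a => g (.inr (.inr (.inr (.inl a)))) : Fin (q + 2) → M) a
  | .x i k => (Fin.cons (∑ j, α i j • y j + ∑ j, β i j • u j -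
      ∑ k, g (.inr (.inr (.inr (.inr ⟨i, k⟩))))) fun k => g (.inr (.inr (.inr (.inr ⟨i, k⟩)))) :
        Fin (blockDeg α β i + 1) → M) k

variable {α β : ι → Fin (p + 1) → ℕ} {M N : Type} [AddCommGroup M] [AddCommGroup N]

lemma extend_toVtx (g : BasisIdx p q (blockDeg α β) → M) (b : BasisIdx p q (blockDeg α β)) :
    extend g b.toVtx = g b := by
  rcases b with _ | _ | _ | _ | ⟨i, k⟩ <;> rfl

lemma rel_extend (g : BasisIdx p q (blockDeg α β) → M) : VtxRel α β (extend g) where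
  tz := add_neg_cancel _
  yu := by simp [extend, Fin.sum_univ_succ (n := p)]; abel
  vy := by simp only [extend, Fin.sum_univ_succ (n := q + 1), Fin.cons_zero, Fin.cons_succ]; abel
  x i := by
    simp only [extend, Fin.sum_univ_succ (n := blockDeg α β i), Fin.cons_zero, Fin.cons_succ]
    abel

lemma _root_.VtxRel.eq_extend {f : Vtx p q (blockDeg α β) → M} (hf : VtxRel α β f) :
    f = extend fun b => f b.toVtx := by
  have hz : f .z = -f .t := (neg_eq_of_add_eq_zero_right hf.tz).symm
  have hu : ∀ j, f (.u j) = extend (fun b => f b.toVtx) (.u j) := fun j => by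
    refine Fin.cases ?_ (fun j => ?_) j
    · have h := hf.yu
      rw [Fin.sum_univ_succ (fun j => f (.u j)), hz] at h
      simp only [extend, toVtx, Fin.cons_zero]
      rw [← sub_eq_add_neg] at h
      rw [h]; abel
    · simp [extend, toVtx]
  ext x
  cases x with
  | t => rfl
  | z => exact hz
  | y j => rfl
  | u j => exact hu j
  | v a =>
    refine Fin.cases ?_ (fun j => ?_) a
    · have h := hf.vy
      rw [Fin.sum_univ_succ (fun j => f (.v j))] at h
      simp only [extend, toVtx, Fin.cons_zero]
      rw [← h]; abel
    · simp [extend, toVtx]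
  | x i k =>
    refine Fin.cases ?_ (fun j => ?_) k
    · have h := hf.x i
      rw [Fin.sum_univ_succ (fun j => f (.x i j))] at h
      simp only [hu] at h
      have h' := eq_sub_of_add_eq h
      rw [h']
      rfl
    · simp [extend, toVtx]

lemma map_extend (φ : M →+ N) (g : BasisIdx p q (blockDeg α β) → M) :
    (fun x => φ (extend g x)) = extend fun b => φ (g b) := by
  rw [((rel_extend g).map φ).eq_extend]
  simp only [extend_toVtx]

end BasisIdx

open BasisIdx in
/-- In the right dimension, a basis of the lattice extends to a realization. -/
theorem exists_isRealization {p q : ℕ} {ι : Type} [Fintype ι] (α β : ι → Fin (p + 1) → ℕ) {n : ℕ}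
    (hn : n = 2 * p + q + 3 + ∑ i, blockDeg α β i) :
    ∃ e : Vtx p q (blockDeg α β) → Fin n → ℤ, IsRealization α β e := by
  have hcard : Fintype.card (BasisIdx p q (blockDeg α β)) = n := by
    simp [hn]
    ring
  let b : Module.Basis (BasisIdx p q (blockDeg α β)) ℤ (Fin n → ℤ) :=
    (Pi.basisFun ℤ (Fin n)).reindex (Fintype.equivFinOfCardEq hcard).symm
  refine ⟨extend b, rel_extend b, ?_, fun {M} _ f hf => ?_⟩
  · have h : range b ⊆ range (extend (α := α) (β := β) b) := by
      rintro _ ⟨i, rfl⟩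
      exact ⟨_, extend_toVtx _ _⟩
    refine top_le_iff.1 (le_trans (fun w _ => ?_) (AddSubgroup.closure_mono h))
    rw [← b.sum_repr w]
    exact AddSubgroup.sum_mem _ fun i _ =>
      AddSubgroup.zsmul_mem _ (AddSubgroup.subset_closure (mem_range_self i)) _
  · refine ⟨(b.constr ℤ fun i => f i.toVtx).toAddMonoidHom, fun x => ?_⟩
    refine (congrFun (map_extend _ _) x).trans ?_
    conv_rhs => rw [hf.eq_extend]
    simp only [LinearMap.toAddMonoidHom_coe, Module.Basis.constr_basis]

lemma IsRealization.comp {p q : ℕ} {ι : Type} {α β : ι → Fin (p + 1) → ℕ} {n : ℕ}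
    {e : Vtx p q (blockDeg α β) → Fin n → ℤ} (he : IsRealization α β e)
    (A : (Fin n → ℤ) ≃+ (Fin n → ℤ)) : IsRealization α β fun x => A (e x) where
  rel := he.rel.map A.toAddMonoidHom
  closure_eq_top := by
    have : range (fun x => A (e x)) = A.toAddMonoidHom '' range e := by
      rw [← range_comp]; rfl
    rw [this, ← AddMonoidHom.map_closure, he.closure_eq_top]
    exact AddSubgroup.map_top_of_surjective _ A.surjective
  lift f hf := by
    obtain ⟨g, hg⟩ := he.lift f hf
    exact ⟨g.comp A.symm.toAddMonoidHom, fun x => by simp [hg]⟩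

/-! ### Unimodular equivalence and isolation -/

/-- An affine map that maps `ℤⁿ` onto `ℤⁿ` is a linear automorphism of the lattice followed by a lattice
translation. -/
lemma exists_linearEquiv_of_image_stdLattice {n : ℕ} {φ : (Fin n → ℝ) →ᵃ[ℝ] (Fin n → ℝ)}
    (hφ : φ '' stdLattice n = stdLattice n) :
    ∃ (L : (Fin n → ℝ) ≃ₗ[ℝ] (Fin n → ℝ)) (A : (Fin n → ℤ) ≃+ (Fin n → ℤ)) (c : Fin n → ℤ),
      (∀ x, φ x = L x + latticeEmb c) ∧ ∀ w, L (latticeEmb w) = latticeEmb (A w) := by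
  have h1 : ∀ w, ∃ v, latticeEmb v = φ (latticeEmb w) := fun w => by
    have : φ (latticeEmb w) ∈ stdLattice n := hφ ▸ mem_image_of_mem φ (mem_range_self w)
    exact this
  choose f hf using h1
  have hφ0 : ∀ x, φ x = φ.linear x + latticeEmb (f 0) := fun x => by
    have h0 : latticeEmb (0 : Fin n → ℤ) = 0 := map_zero (latticeHom n)
    rw [hf, h0, φ.decomp']
    simp
  have hlin : ∀ w, φ.linear (latticeEmb w) = latticeEmb (f w - f 0) := fun w => by
    rw [← latticeHom_apply (f w - f 0), map_sub, latticeHom_apply, latticeHom_apply, hf w, hφ0,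
      add_sub_cancel_right]
  let a : (Fin n → ℤ) →+ (Fin n → ℤ) := AddMonoidHom.mk' (fun w => f w - f 0) fun v w =>
    latticeEmb_injective (by
      rw [← hlin, ← latticeHom_apply (v + w), map_add, map_add, latticeHom_apply, latticeHom_apply,
        hlin, hlin, ← latticeHom_apply (f v - f 0 + _), map_add]
      rfl)
  have ha : ∀ w, φ.linear (latticeEmb w) = latticeEmb (a w) := hlin
  have hsurj : Function.Surjective a := fun v => by
    have : latticeEmb (v + f 0) ∈ φ '' stdLattice n := by
      rw [hφ]; exact mem_range_self _
    obtain ⟨_, ⟨w, rfl⟩, hw⟩ := this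
    rw [← hf] at hw
    exact ⟨w, sub_eq_of_eq_add (latticeEmb_injective hw)⟩
  have hinj : Function.Injective a :=
    OrzechProperty.injective_of_surjective_endomorphism a.toIntLinearMap hsurj
  have hLsurj : Function.Surjective φ.linear := by
    rw [← LinearMap.range_eq_top]
    by_contra hne
    obtain ⟨μ, hμ0, hμ⟩ := Submodule.exists_le_ker_of_lt_top _ (lt_top_iff_ne_top.2 hne)
    refine hμ0 (linear_eq_zero_of_closure (AddSubgroup.closure_univ) fun w _ => ?_)
    obtain ⟨v, rfl⟩ := hsurj w
    rw [← ha]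
    exact hμ (LinearMap.mem_range_self _ _)
  have hLinj : Function.Injective φ.linear := LinearMap.injective_iff_surjective.2 hLsurj
  exact ⟨LinearEquiv.ofBijective φ.linear ⟨hLinj, hLsurj⟩, AddEquiv.ofBijective a ⟨hinj, hsurj⟩,
    f 0, hφ0, ha⟩

lemma UnimodularlyEquivalent.trans {n : ℕ} {P Q R : Set (Fin n → ℝ)}
    (h : UnimodularlyEquivalent P Q) (h' : UnimodularlyEquivalent Q R) :
    UnimodularlyEquivalent P R := by
  obtain ⟨φ, hφ, rfl⟩ := h
  obtain ⟨ψ, hψ, rfl⟩ := h'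
  refine ⟨ψ.comp φ, ?_, ?_⟩
  · rw [AffineMap.coe_comp, image_comp, hφ, hψ]
  · rw [AffineMap.coe_comp, image_comp]

lemma UnimodularlyEquivalent.symm {n : ℕ} {P Q : Set (Fin n → ℝ)}
    (h : UnimodularlyEquivalent P Q) : UnimodularlyEquivalent Q P := by
  obtain ⟨φ, hφ, rfl⟩ := h
  obtain ⟨L, -, c, hL, -⟩ := exists_linearEquiv_of_image_stdLattice hφ
  have hbij : Function.Bijective φ := by
    have : (φ : (Fin n → ℝ) → (Fin n → ℝ)) = (Equiv.addRight (latticeEmb c)) ∘ L := funext hL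
    rw [this]
    exact (Equiv.bijective _).comp L.bijective
  have key : ∀ s, (AffineEquiv.ofBijective hbij).symm.toAffineMap '' (φ '' s) = s := fun s => by
    rw [image_image]
    refine (image_congr fun x _ => ?_).trans (image_id s)
    exact (AffineEquiv.ofBijective hbij).symm_apply_apply x
  refine ⟨(AffineEquiv.ofBijective hbij).symm.toAffineMap, ?_, key P⟩
  conv_lhs => rw [← hφ]
  exact key _

/-- The polytope whose vertices are the given lattice points. -/
abbrev hullOf {n : ℕ} {T : Type} (pt : T → Fin n → ℤ) : Set (Fin n → ℝ) :=
  convexHull ℝ (range fun x => latticeEmb (pt x))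

namespace IsRealization

variable {p q : ℕ} {ι : Type} [Fintype ι] {α β : ι → Fin (p + 1) → ℕ} {n : ℕ}
  {e : Vtx p q (blockDeg α β) → Fin n → ℤ}

/-- The polytopes that are unimodularly equivalent to the given one come from realizations, too, since the
origin is the only lattice point in its interior and therefore is preserved. -/
lemma exists_of_unimodularlyEquivalent (he : IsRealization α β e)
    (hn : n = 2 * p + q + 3 + ∑ i, blockDeg α β i) (hd : ∀ i, 0 < blockDeg α β i)
    {S : Set (Fin n → ℝ)} (hS : IsSmoothFano S) (h : UnimodularlyEquivalent (hullOf e) S) :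
    ∃ e' : Vtx p q (blockDeg α β) → Fin n → ℤ, IsRealization α β e' ∧
      vertexSet S = latticeEmb '' range e' := by
  have hsys := he.isFacetSystem hn hd
  have hn0 : 0 < n := by omega
  obtain ⟨φ, hφ, rfl⟩ := h
  obtain ⟨L, A, c, hL, hA⟩ := exists_linearEquiv_of_image_stdLattice hφ
  have hc : c = 0 := by
    by_contra hc
    obtain ⟨a, ha⟩ := A.surjective (-c)
    have ha0 : a ≠ 0 := by
      rintro rfl
      rw [map_zero] at ha
      exact hc (neg_eq_zero.1 ha.symm)
    obtain ⟨F, hF⟩ := hsys.exists_fn_pos hn0 ha0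
    obtain ⟨ψ, hψ⟩ := IsFacetSystem.exists_real_fn he.fn F
    -- The facet functional `F`, transported to the image polytope, is less than its maximum at the origin.
    set χ : (Fin n → ℝ) →ₗ[ℝ] ℝ := ψ ∘ₗ L.symm.toLinearMap with hχ
    have hχL : ∀ x, χ (L x) = ψ x := fun x => by simp [hχ]
    have hχc : χ (latticeEmb c) = -(he.fn F a : ℝ) := by
      have h1 : latticeEmb c = L (-latticeEmb a) := by
        rw [map_neg, hA, ha, ← latticeHom_apply, ← latticeHom_apply, map_neg, neg_neg]
      rw [h1, hχL, map_neg, hψ]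
    have hle : ∀ s ∈ φ '' hullOf e, χ s ≤ 1 + χ (latticeEmb c) := by
      rintro _ ⟨x, hx, rfl⟩
      rw [hL, map_add, hχL]
      gcongr
      refine linear_le_of_mem_convexHull ?_ hx
      rintro _ ⟨y, rfl⟩
      rw [hψ]
      have := hsys.fn_pt F y
      have h1 : he.fn F (e y) ≤ 1 := by omega
      exact_mod_cast h1
    have hne : χ ≠ 0 := fun h => by
      rw [h, LinearMap.zero_apply] at hχc
      have : he.fn F a = 0 := by exact_mod_cast neg_eq_zero.1 hχc.symm
      omega
    have hlt := linear_lt_of_mem_interior hle hne hS.2.1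
    rw [map_zero, hχc] at hlt
    have : (he.fn F a : ℝ) < 1 := by linarith
    have : he.fn F a < 1 := by exact_mod_cast this
    omega
  refine ⟨fun x => A (e x), he.comp A, ?_⟩
  have hφL : φ '' hullOf e = L '' hullOf e := image_congr fun x _ => by
    have h0 : latticeEmb (0 : Fin n → ℤ) = 0 := map_zero (latticeHom n)
    rw [hL, hc, h0, add_zero]
  rw [hφL, vertexSet, ← image_extremePoints, ← vertexSet, hsys.vertexSet_eq, ← range_comp,
    ← range_comp]
  exact congrArg range (funext fun x => hA (e x))

/-- No step of an I-equivalence can leave the polytope, hence it is I-isolated. -/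
theorem isIIsolated (he : IsRealization α β e) (hn : n = 2 * p + q + 3 + ∑ i, blockDeg α β i)
    (hd : ∀ i, 0 < blockDeg α β i) (hr : IsRigid α β) : IsIIsolated (hullOf e) := by
  rintro Q - ⟨k, S, hS, hP, hQ, hstep⟩
  rcases k.eq_zero_or_pos with rfl | hk
  · exact hP.trans hQ.symm
  exfalso
  obtain ⟨e', he', hV⟩ := he.exists_of_unimodularlyEquivalent hn hd (hS 0 (by omega)) hP
  have hinj := (he'.isFacetSystem hn hd).pt_injective
  rcases hstep 0 hk with ⟨_, ⟨w, rfl⟩, hw, hV'⟩ | ⟨_, ⟨w, rfl⟩, hw, hV'⟩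
  · refine he'.not_add_vertex hn hd (hS 1 hk) (w := w) ?_ fun h => hw (hV ▸ mem_image_of_mem _ h)
    rw [hV', hV, image_insert_eq, union_singleton]
  · obtain ⟨_, ⟨x₀, rfl⟩, hx₀⟩ : latticeEmb w ∈ latticeEmb '' range e' := by
      rw [← hV, hV']
      exact mem_union_right _ rfl
    refine he'.not_remove_vertex hinj (by omega) hd hr (hS 1 hk) x₀ ?_
    rw [image_sdiff latticeEmb_injective, ← hV, hV', image_singleton, hx₀, union_sdiff_right,
      sdiff_singleton_eq_self hw]

end IsRealization

/-- The polytope that the family provides for given parameters. -/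
lemma exists_isIIsolated {p q : ℕ} {ι : Type} [Fintype ι] {α β : ι → Fin (p + 1) → ℕ} {n : ℕ}
    (hn : n = 2 * p + q + 3 + ∑ i, blockDeg α β i) (hd : ∀ i, 0 < blockDeg α β i)
    (hr : IsRigid α β) : ∃ P : Set (Fin n → ℝ), IsSmoothFano P ∧ IsIIsolated P ∧
      (vertexSet P).ncard = n + (3 + Fintype.card ι) := by
  obtain ⟨e, he⟩ := exists_isRealization α β hn
  have hsys := he.isFacetSystem hn hd
  refine ⟨hullOf e, hsys.isSmoothFano (by omega), he.isIIsolated hn hd hr, ?_⟩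
  rw [hsys.ncard_vertexSet, Nat.card_congr (vtxEquiv p q (blockDeg α β)), Nat.card_eq_fintype_card]
  simp [Finset.sum_add_distrib]
  omega

theorem corollary4p6 (n ρ : ℕ) (hn : 5 ≤ n) (hρ : 3 ≤ ρ) (hρn : ρ ≤ n) :
    ∃ P : Set (Fin n → ℝ), IsSmoothFano P ∧ IsIIsolated P ∧ (vertexSet P).ncard = n + ρ := by
  obtain rfl | rfl | h5 : ρ = 3 ∨ ρ = 4 ∨ 5 ≤ ρ := by omega
  · exact exists_isIIsolated (p := 1) (q := n - 5) (ι := Fin 0) (α := fun _ _ => 0)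
      (β := fun _ _ => 0) (by simp; omega) (fun i => i.elim0) (.inl ⟨le_rfl, inferInstance⟩)
  · exact exists_isIIsolated (p := 0) (q := n - 5) (ι := Fin 1) (α := fun _ _ => 1)
      (β := fun _ _ => 1) (by simp [blockDeg]; omega) (fun i => by simp [blockDeg])
      (.inr ⟨rfl, by simp, by simp, by simp⟩)
  · -- One block has the sum `y`, all others have the sum `u`.
    have h : ∀ i : Fin (ρ - 3), blockDeg (p := 0) (ι := Fin (ρ - 3)) (fun i _ => if (i : ℕ) = 0 then 1 else 0)
        (fun i _ => if (i : ℕ) = 0 then 0 else 1) i = 1 := fun i => by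
      simp only [blockDeg]
      split_ifs <;> simp
    obtain ⟨P, hP, hI, hcard⟩ := exists_isIIsolated (p := 0) (q := n - ρ) (n := n)
      (ι := Fin (ρ - 3)) (α := fun i _ => if (i : ℕ) = 0 then 1 else 0)
      (β := fun i _ => if (i : ℕ) = 0 then 0 else 1) (by simp only [h]; simp; omega)
      (fun i => by rw [h]; exact one_pos)
      (.inr ⟨rfl, fun i => by dsimp only; split_ifs <;> simp, ⟨⟨0, by omega⟩, by simp⟩,
        ⟨⟨1, by omega⟩, by simp⟩⟩)
    refine ⟨P, hP, hI, ?_⟩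
    rw [hcard, Fintype.card_fin]
    omega
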